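/- Let $K$ be a field, let $P=K[x_1,\dots,x_n]$ be graded by $\deg x_j=w_j$ with positive integers $w_1,\dots,w_n$, and let $\overline P=K[y,x_1,\dots,x_n]$ with $\deg y=1$. Let $F=P^r$ and let $\overline F=\bigoplus_{i=1}^r\overline P(-\delta_i)$ with $\delta_i\in\mathbb Z$; thus $e_i$ has degree $\delta_i$, and terms $t\,e_i$ of $F$ and of $\overline F$ have a degree in $\mathbb Z$. Let $\sigma$ be a module ordering on the terms $t\,e_i$ of $F$ (a total order that is preserved by multiplication with terms and is compatible with a monoid ordering on the terms of $P$), and let $\overline\sigma$ be its extension to the terms of $\overline F$: compare degrees first, and for equal degrees compare with respect to $\sigma$ the terms obtained by putting $y=1$. For $V\in\overline F$ let $V^{\rm deh}\in F$ be obtained by putting $y=1$. For $v\in F$ let $v^{\rm hom}\in\overline F$ be obtained by multiplying each term of $v$ of degree $d$ by $y^{\mu-d}$, where $\mu$ is the maximal degree of a term of $v$ (and $0^{\rm hom}=0$). Put $V^{\rm sat}=(V^{\rm deh})^{\rm hom}$ for homogeneous $V$. For a graded submodule $N\subseteq\overline F$ let $N^{\rm deh}=\{V^{\rm deh} : V\in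 N\}$, and let $N^{\rm sat}=(N^{\rm deh})^{\rm hom}$ be the submodule of $\overline F$ generated by all $v^{\rm hom}$ with $v\in N^{\rm deh}$. SelfSatBA, applied to homogeneous vectors $U_1,\dots,U_s\in\overline F$, is the following procedure. Start with ${\rm Gens}=(U_1,\dots,U_s)$, ${\rm Pairs}=\emptyset$, $\mathcal G=\emptyset$. While ${\rm Gens}\neq\emptyset$ or ${\rm Pairs}\neq\emptyset$: remove some $W$ from ${\rm Gens}$, or remove some pair from ${\rm Pairs}$ and let $W$ be its S-vector; compute a remainder $R$ of $W$ by $\mathcal G$ with respect to $\overline\sigma$ (a vector reached from $W$ by steps of the division algorithm which is zero or whose leading term is divisible by no leading term of an element of $\mathcal G$), and let $V=R^{\rm sat}$; if $V\neq 0$, add to ${\rm Pairs}$ the pairs $(V,V')$ with $V'\in\mathcal G$ whose leading term lies in the same component of $\overline F$ as that of $V$, and add $V$ to $\mathcal G$. When the loop ends, return $\mathcal G$. Let $N$ be a graded submodule of $\overline F$. Then every run of SelfSatBA on a finite tuple of homogeneous generators of $N$ terminates, whatever choices are made. Let $\{V_1,\dots,V_t\}$ be its output. 1. We have $V_i=V_i^{\rm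 sat}$ for $i=1,\dots,t$. 2. If $\sigma$ is compatible with the degree, that is, if $t\,e_i\le_\sigma t'e_j$ implies $\deg(t\,e_i)\le\deg(t'e_j)$, then $\{V_1,\dots,V_t\}$ is a $\overline\sigma$-Gröbner basis of $N^{\rm sat}$. -/

import Mathlib

namespace SelfSat

open MvPolynomial

/-- A monoid ordering on the power products with exponents in `ι →₀ ℕ`: a total order that is
compatible with multiplication (no well-foundedness is required). -/
structure MonoidOrdering (ι : Type*) where
  le : (ι →₀ ℕ) → (ι →₀ ℕ) → Prop
  antisymm : ∀ a b, le a b → le b a → a = b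
  trans : ∀ a b c, le a b → le b c → le a c
  total : ∀ a b, le a b ∨ le b a
  add_le : ∀ a b c, le a b → le (c + a) (c + b)

/-- The terms `t e_i` of the free module of rank `r`; the pair `(i, a)` stands for `x^a e_i`. -/
abbrev MTerm (ι : Type*) (r : ℕ) := Fin r × (ι →₀ ℕ)

/-- A module ordering on the terms `t e_i` that is compatible with some monoid ordering. -/
structure ModuleOrdering (ι : Type*) (r : ℕ) where
  le : MTerm ι r → MTerm ι r → Prop
  antisymm : ∀ s t, le s t → le t s → s = t
  trans : ∀ s t u, le s t → le t u → le s u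
  total : ∀ s t, le s t ∨ le t s
  mul_le : ∀ (s t : MTerm ι r) (c : ι →₀ ℕ), le s t → le (s.1, c + s.2) (t.1, c + t.2)
  compat : ∃ τ : MonoidOrdering ι, ∀ (a b : ι →₀ ℕ) (i : Fin r), τ.le a b → le (i, a) (i, b)

/-- The free module of rank `r` over the polynomial ring `K[ι]`. -/
abbrev Vect (ι : Type*) (r : ℕ) (K : Type*) [Field K] := Fin r → MvPolynomial ι K

section Generic

variable {ι : Type*} {r : ℕ} {K : Type*} [Field K]

/-- The coefficient of a term in a vector. -/
def vcoeff (v : Vect ι r K) (t : MTerm ι r) : K := coeff t.2 (v t.1)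

/-- `t` is the leading term of `v`. The zero vector has no leading term. -/
def IsLeadingTerm (ρ : ModuleOrdering ι r) (v : Vect ι r K) (t : MTerm ι r) : Prop :=
  vcoeff v t ≠ 0 ∧ ∀ s, vcoeff v s ≠ 0 → ρ.le s t

/-- The leading terms of the non-zero elements of `S`, as elements of the free module. -/
def leadingTerms (ρ : ModuleOrdering ι r) (S : Set (Vect ι r K)) : Set (Vect ι r K) :=
  {m | ∃ v ∈ S, ∃ t, IsLeadingTerm ρ v t ∧ m = Pi.single t.1 (monomial t.2 1)}

/-- `G` is a Gröbner basis of the submodule `N`: its elements are non-zero and generate `N`, and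
their leading terms generate the leading term module of `N`. -/
structure IsGroebnerBasis (ρ : ModuleOrdering ι r) (G : Set (Vect ι r K))
    (N : Submodule (MvPolynomial ι K) (Vect ι r K)) : Prop where
  ne_zero : ∀ g ∈ G, g ≠ 0
  span_eq : Submodule.span (MvPolynomial ι K) G = N
  lead : Submodule.span (MvPolynomial ι K) (leadingTerms ρ (N : Set (Vect ι r K))) =
    Submodule.span (MvPolynomial ι K) (leadingTerms ρ G)

/-- The leading terms of `u` and `v` lie in the same component of the free module. -/
def SameComponent (ρ : ModuleOrdering ι r) (u v : Vect ι r K) : Prop :=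
  ∃ i a b, IsLeadingTerm ρ u (i, a) ∧ IsLeadingTerm ρ v (i, b)

/-- `w` is the S-vector of `u` and `v`: with `LM(u) = c x^a e_i` and `LM(v) = d x^b e_i`,
`w = lcm(x^a, x^b) / (c x^a) u - lcm(x^a, x^b) / (d x^b) v`. -/
def IsSVector (ρ : ModuleOrdering ι r) (u v w : Vect ι r K) : Prop :=
  ∃ i a b, IsLeadingTerm ρ u (i, a) ∧ IsLeadingTerm ρ v (i, b) ∧
    w = monomial (a ⊔ b - a) (vcoeff u (i, a))⁻¹ • u -
        monomial (a ⊔ b - b) (vcoeff v (i, b))⁻¹ • v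

/-- One step of the division algorithm: some term of `v` that is a multiple `x^c LT(g)` of the
leading term of some `g ∈ G` is cancelled by subtracting the right multiple of `g`. -/
def ReducesTo (ρ : ModuleOrdering ι r) (G : List (Vect ι r K)) (v v' : Vect ι r K) : Prop :=
  ∃ g ∈ G, ∃ i b c, IsLeadingTerm ρ g (i, b) ∧ vcoeff v (i, c + b) ≠ 0 ∧
    v' = v - monomial c (vcoeff v (i, c + b) / vcoeff g (i, b)) • g

/-- `u` is a remainder of `w` by `G`: it is reached from `w` by finitely many division steps, and
its leading term (if `u ≠ 0`) is not divisible by the leading term of any element of `G`.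
This covers the full division algorithm, its variant that reduces leading terms only, and every
order of the divisors. -/
def IsRemainder (ρ : ModuleOrdering ι r) (w : Vect ι r K) (G : List (Vect ι r K))
    (u : Vect ι r K) : Prop :=
  Relation.ReflTransGen (ReducesTo ρ G) w u ∧
    ∀ g ∈ G, ∀ i a b, IsLeadingTerm ρ u (i, a) → IsLeadingTerm ρ g (i, b) → ¬ b ≤ a

end Generic

section Homogenization

/-! The ring `P` is `MvPolynomial (Fin n) K`, the ring `P̄` is `MvPolynomial (Option (Fin n)) K`,
where the variable `none` is the homogenizing indeterminate `y`. -/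

variable {n r : ℕ} {K : Type*} [Field K]

/-- The degree of the term `x^a e_i`, where `x_j` has degree `W j` and `e_i` has degree `δ i`. -/
noncomputable def deg (W : Fin n → ℤ) (δ : Fin r → ℤ) (t : MTerm (Fin n) r) : ℤ :=
  Finsupp.weight W t.2 + δ t.1

/-- Setting `y = 1` in a term. -/
noncomputable def dehTerm (t : MTerm (Option (Fin n)) r) : MTerm (Fin n) r := (t.1, t.2.some)

/-- The degree of a term over `P̄`, where moreover `y` has degree `1`. -/
noncomputable def degBar (W : Fin n → ℤ) (δ : Fin r → ℤ) (t : MTerm (Option (Fin n)) r) : ℤ :=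
  (t.2 none : ℤ) + deg W δ (dehTerm t)

theorem eq_of_degBar_eq (W : Fin n → ℤ) (δ : Fin r → ℤ) (s t : MTerm (Option (Fin n)) r)
    (h : degBar W δ s = degBar W δ t) (h' : dehTerm s = dehTerm t) : s = t := by
  unfold degBar at h
  rw [h'] at h
  obtain ⟨i, a⟩ := s
  obtain ⟨j, b⟩ := t
  simp only [dehTerm, Prod.mk.injEq] at h' h ⊢
  refine ⟨h'.1, ?_⟩
  ext o
  cases o with
  | none => omega
  | some k => simpa using DFunLike.congr_fun h'.2 k

theorem degBar_add (W : Fin n → ℤ) (δ : Fin r → ℤ) (t : MTerm (Option (Fin n)) r)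
    (c : Option (Fin n) →₀ ℕ) :
    degBar W δ (t.1, c + t.2) = (c none : ℤ) + Finsupp.weight W c.some + degBar W δ t := by
  simp only [degBar, deg, dehTerm, Finsupp.some_add, map_add, Finsupp.add_apply]
  push_cast
  ring

/-- The extension of a monoid ordering: compare degrees first, then dehomogenizations. -/
noncomputable def MonoidOrdering.extend (τ : MonoidOrdering (Fin n)) (W : Fin n → ℤ) :
    MonoidOrdering (Option (Fin n)) where
  le a b :=
    (a none : ℤ) + Finsupp.weight W a.some < (b none : ℤ) + Finsupp.weight W b.some ∨
    ((a none : ℤ) + Finsupp.weight W a.some = (b none : ℤ) + Finsupp.weight W b.some ∧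
      τ.le a.some b.some)
  antisymm := by
    rintro a b (h | ⟨h, h1⟩) (h' | ⟨h', h2⟩)
    · omega
    · omega
    · omega
    · have e := τ.antisymm _ _ h1 h2
      rw [e] at h
      ext o
      cases o with
      | none => omega
      | some k => simpa using DFunLike.congr_fun e k
  trans := by
    rintro a b c (h | ⟨h, h1⟩) (h' | ⟨h', h2⟩)
    · exact Or.inl (h.trans h')
    · exact Or.inl (h.trans_eq h')
    · exact Or.inl (h.trans_lt h')
    · exact Or.inr ⟨h.trans h', τ.trans _ _ _ h1 h2⟩
  total := by
    intro a b
    rcases lt_trichotomy ((a none : ℤ) + Finsupp.weight W a.some)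
      ((b none : ℤ) + Finsupp.weight W b.some) with h | h | h
    · exact Or.inl (Or.inl h)
    · rcases τ.total a.some b.some with h' | h'
      · exact Or.inl (Or.inr ⟨h, h'⟩)
      · exact Or.inr (Or.inr ⟨h.symm, h'⟩)
    · exact Or.inr (Or.inl h)
  add_le := by
    rintro a b c (h | ⟨h, h'⟩)
    · left
      simp only [Finsupp.some_add, map_add, Finsupp.add_apply]
      push_cast
      omega
    · right
      refine ⟨?_, ?_⟩
      · simp only [Finsupp.some_add, map_add, Finsupp.add_apply]
        push_cast
        omega
      · rw [Finsupp.some_add, Finsupp.some_add]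
        exact τ.add_le _ _ _ h'

/-- The extension `σ̄` of a module ordering `σ` by the grading: compare degrees first, and for
equal degrees compare the dehomogenized terms with respect to `σ`. -/
noncomputable def ModuleOrdering.extend (σ : ModuleOrdering (Fin n) r) (W : Fin n → ℤ) (δ : Fin r → ℤ) :
    ModuleOrdering (Option (Fin n)) r where
  le s t := degBar W δ s < degBar W δ t ∨
    (degBar W δ s = degBar W δ t ∧ σ.le (dehTerm s) (dehTerm t))
  antisymm := by
    rintro s t (h | ⟨h, h1⟩) (h' | ⟨h', h2⟩)
    · omega
    · omega
    · omega
    · exact eq_of_degBar_eq W δ s t h (σ.antisymm _ _ h1 h2)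
  trans := by
    rintro a b c (h | ⟨h, h1⟩) (h' | ⟨h', h2⟩)
    · exact Or.inl (h.trans h')
    · exact Or.inl (h.trans_eq h')
    · exact Or.inl (h.trans_lt h')
    · exact Or.inr ⟨h.trans h', σ.trans _ _ _ h1 h2⟩
  total := by
    intro a b
    rcases lt_trichotomy (degBar W δ a) (degBar W δ b) with h | h | h
    · exact Or.inl (Or.inl h)
    · rcases σ.total (dehTerm a) (dehTerm b) with h' | h'
      · exact Or.inl (Or.inr ⟨h, h'⟩)
      · exact Or.inr (Or.inr ⟨h.symm, h'⟩)
    · exact Or.inr (Or.inl h)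
  mul_le := by
    rintro s t c (h | ⟨h, h'⟩)
    · left
      rw [degBar_add, degBar_add]
      omega
    · right
      refine ⟨by rw [degBar_add, degBar_add]; omega, ?_⟩
      simpa only [dehTerm, Finsupp.some_add] using σ.mul_le (dehTerm s) (dehTerm t) c.some h'
  compat := by
    obtain ⟨τ, hτ⟩ := σ.compat
    refine ⟨τ.extend W, ?_⟩
    rintro a b i (h | ⟨h, h'⟩)
    · left
      simp only [degBar, deg, dehTerm]
      omega
    · right
      refine ⟨?_, hτ _ _ _ h'⟩
      simp only [degBar, deg, dehTerm]
      omega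

/-- `σ` is compatible with the degree: larger terms have larger or equal degree. -/
def ModuleOrdering.DegCompatible (σ : ModuleOrdering (Fin n) r) (W : Fin n → ℤ)
    (δ : Fin r → ℤ) : Prop :=
  ∀ s t, σ.le s t → deg W δ s ≤ deg W δ t

/-- A vector over `P̄` is homogeneous if all its terms have the same degree. -/
def IsHomogeneousVec (W : Fin n → ℤ) (δ : Fin r → ℤ) (V : Vect (Option (Fin n)) r K) : Prop :=
  ∃ d : ℤ, ∀ t, vcoeff V t ≠ 0 → degBar W δ t = d

/-- The top degree of a vector over `P`: the maximal degree of its terms (`0` for the zero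
vector). -/
noncomputable def topDeg (W : Fin n → ℤ) (δ : Fin r → ℤ) (v : Vect (Fin n) r K) : ℤ :=
  (Finset.univ.sup fun i => (v i).support.sup fun a => ((deg W δ (i, a) : ℤ) : WithBot ℤ)).unbotD 0

/-- The homogenization of a vector: every term `t` is multiplied by the power of `y` whose exponent
is the (non-negative) difference of the top degree and the degree of `t`. -/
noncomputable def hom (W : Fin n → ℤ) (δ : Fin r → ℤ) (v : Vect (Fin n) r K) :
    Vect (Option (Fin n)) r K :=
  fun i => ∑ a ∈ (v i).support,
    monomial (a.optionElim (topDeg W δ v - deg W δ (i, a)).toNat) (coeff a (v i))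

/-- The dehomogenization of a vector: `y` is set to `1`. -/
noncomputable def deh (V : Vect (Option (Fin n)) r K) : Vect (Fin n) r K :=
  fun i => aeval (fun o : Option (Fin n) => o.elim (1 : MvPolynomial (Fin n) K) X) (V i)

/-- The saturation of a homogeneous vector. -/
noncomputable def sat (W : Fin n → ℤ) (δ : Fin r → ℤ) (V : Vect (Option (Fin n)) r K) :
    Vect (Option (Fin n)) r K :=
  hom W δ (deh V)

/-- The dehomogenization of a submodule. The image is itself a submodule, so that taking the span
does not enlarge it. -/
noncomputable def dehModule
    (N : Submodule (MvPolynomial (Option (Fin n)) K) (Vect (Option (Fin n)) r K)) :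
    Submodule (MvPolynomial (Fin n) K) (Vect (Fin n) r K) :=
  Submodule.span _ (deh '' (N : Set (Vect (Option (Fin n)) r K)))

/-- The homogenization of a submodule: it is generated by the homogenizations of the elements. -/
noncomputable def homModule (W : Fin n → ℤ) (δ : Fin r → ℤ)
    (M : Submodule (MvPolynomial (Fin n) K) (Vect (Fin n) r K)) :
    Submodule (MvPolynomial (Option (Fin n)) K) (Vect (Option (Fin n)) r K) :=
  Submodule.span _ (hom W δ '' (M : Set (Vect (Fin n) r K)))

/-- The saturation of a graded submodule. -/
noncomputable def satModule (W : Fin n → ℤ) (δ : Fin r → ℤ)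
    (N : Submodule (MvPolynomial (Option (Fin n)) K) (Vect (Option (Fin n)) r K)) :
    Submodule (MvPolynomial (Option (Fin n)) K) (Vect (Option (Fin n)) r K) :=
  homModule W δ (dehModule N)

end Homogenization

section Algorithm

variable {n r : ℕ} {K : Type*} [Field K]

/-- The state of the algorithm: the generators and the pairs still to be treated, and the tuple of
vectors found so far. -/
structure State (n r : ℕ) (K : Type*) [Field K] where
  gens : Multiset (Vect (Option (Fin n)) r K)
  pairs : Multiset (Vect (Option (Fin n)) r K × Vect (Option (Fin n)) r K)
  basis : List (Vect (Option (Fin n)) r K)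

/-- Initialization: the input vectors are the generators; no pairs, no vectors found. -/
def State.init (U : List (Vect (Option (Fin n)) r K)) : State n r K := ⟨U, 0, []⟩

/-- The main loop ends when there are neither generators nor pairs left. -/
def State.IsFinal (s : State n r K) : Prop := s.gens = 0 ∧ s.pairs = 0

/-- The choice of a vector `w`: either a generator is removed and `w` is that generator, or
a pair is removed and `w` is its S-vector. -/
inductive Select (ρ : ModuleOrdering (Option (Fin n)) r) :
    State n r K → Vect (Option (Fin n)) r K → State n r K → Prop
  | gen (w : Vect (Option (Fin n)) r K) (gens : Multiset (Vect (Option (Fin n)) r K))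
      (pairs : Multiset (Vect (Option (Fin n)) r K × Vect (Option (Fin n)) r K))
      (G : List (Vect (Option (Fin n)) r K)) :
      Select ρ ⟨w ::ₘ gens, pairs, G⟩ w ⟨gens, pairs, G⟩
  | pair (u v w : Vect (Option (Fin n)) r K) (gens : Multiset (Vect (Option (Fin n)) r K))
      (pairs : Multiset (Vect (Option (Fin n)) r K × Vect (Option (Fin n)) r K))
      (G : List (Vect (Option (Fin n)) r K)) (h : IsSVector ρ u v w) :
      Select ρ ⟨gens, (u, v) ::ₘ pairs, G⟩ w ⟨gens, pairs, G⟩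

/-- The pairs formed by a new vector `V` and the members of `G` (those for which the S-vector
is defined). -/
noncomputable def newPairs (ρ : ModuleOrdering (Option (Fin n)) r)
    (V : Vect (Option (Fin n)) r K) (G : List (Vect (Option (Fin n)) r K)) :
    Multiset (Vect (Option (Fin n)) r K × Vect (Option (Fin n)) r K) :=
  open Classical in ((G.filter fun U => SameComponent ρ V U).map fun U => (V, U) : List _)

/-- One pass through the main loop of the Self-Saturating Buchberger Algorithm: choose `w`, compute
the saturation `V` of a remainder of `w`, and, if `V ≠ 0`, add `V` to the vectors found and add the
new pairs. -/
inductive Step (σ : ModuleOrdering (Fin n) r) (W : Fin n → ℤ) (δ : Fin r → ℤ) :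
    State n r K → State n r K → Prop
  | discard (s s' : State n r K) (w R : Vect (Option (Fin n)) r K)
      (hw : Select (σ.extend W δ) s w s') (hR : IsRemainder (σ.extend W δ) w s'.basis R)
      (h : sat W δ R = 0) : Step σ W δ s s'
  | keep (s s' : State n r K) (w R : Vect (Option (Fin n)) r K)
      (hw : Select (σ.extend W δ) s w s') (hR : IsRemainder (σ.extend W δ) w s'.basis R)
      (h : sat W δ R ≠ 0) :
      Step σ W δ s
        ⟨s'.gens, s'.pairs + newPairs (σ.extend W δ) (sat W δ R) s'.basis,
          sat W δ R :: s'.basis⟩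

/-- `s` is a state that some run of the algorithm on the input `U` reaches. -/
def Reachable (σ : ModuleOrdering (Fin n) r) (W : Fin n → ℤ) (δ : Fin r → ℤ)
    (U : List (Vect (Option (Fin n)) r K)) (s : State n r K) : Prop :=
  Relation.ReflTransGen (Step σ W δ) (State.init U) s

/-- `G` is an output of the algorithm on the input `U`, for some choices made during the run. -/
def IsOutput (σ : ModuleOrdering (Fin n) r) (W : Fin n → ℤ) (δ : Fin r → ℤ)
    (U G : List (Vect (Option (Fin n)) r K)) : Prop :=
  ∃ s : State n r K, Reachable σ W δ U s ∧ s.IsFinal ∧ s.basis = G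

end Algorithm

end SelfSat

/-! The procedure is Buchberger's algorithm with each remainder R replaced by its saturation V.
Everything stays homogeneous, so R = y^k V for some k (`HasDegree.exists_eq_yPow_sat`). Both
termination and correctness rest on this equation.

Termination: if the leading term of a member of 𝒢 divided LT(V), it would divide y^k LT(V) = LT(R),
which a remainder excludes (`not_leadDivisible_sat`). By Dickson's lemma only finitely many vectors
are added, and a pass that adds none shortens the list of generators and pairs. Remainders exist
because the positive weights make σ̄ well-founded, even if σ is not.

Correctness: R = y^k V is a monomial multiple of the new member V, so every treated vector acquires
a representation by 𝒢 that does not exceed its own terms. At the end all S-vectors have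
representations below the lcm, and Buchberger's criterion (`leadDivisible_of_mem_span`) describes
the leading terms of L = ⟨𝒢⟩. Moreover L contains N, and 𝒢 dehomogenizes into N^deh. To pass from L
to N^sat, let f be in N^sat and let f_d be its component containing LT(f). Then f_d^deh lies in
N^deh, hence is the dehomogenization of a homogeneous element of L. Homogeneous vectors with equal
dehomogenizations agree up to powers of y, so y^k f_d lies in L for some k, and some LT(g) divides
y^k LT(f). If σ is compatible with the degree, the leading term of a saturated g is free of y, so
LT(g) divides LT(f). -/

namespace SelfSat

open MvPolynomial

/-! ### Strict parts and maxima of module orderings. -/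

section Ordering

variable {ι : Type*} {r : ℕ} (ρ : ModuleOrdering ι r)

/-- The strict part of a module ordering. -/
def ModuleOrdering.lt (s t : MTerm ι r) : Prop := ¬ ρ.le t s

variable {ρ}

theorem ModuleOrdering.refl (t : MTerm ι r) : ρ.le t t := (ρ.total t t).elim id id

theorem ModuleOrdering.lt.le {s t : MTerm ι r} (h : ρ.lt s t) : ρ.le s t :=
  (ρ.total s t).resolve_right h

theorem ModuleOrdering.lt_of_le_of_ne {s t : MTerm ι r} (h : ρ.le s t) (hne : s ≠ t) :
    ρ.lt s t :=
  fun h' => hne (ρ.antisymm _ _ h h')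

theorem ModuleOrdering.lt_of_le_of_lt {s t u : MTerm ι r} (h : ρ.le s t) (h' : ρ.lt t u) :
    ρ.lt s u :=
  fun hu => h' (ρ.trans _ _ _ hu h)

theorem ModuleOrdering.mul_lt {s t : MTerm ι r} (c : ι →₀ ℕ) (h : ρ.lt s t) :
    ρ.lt (s.1, c + s.2) (t.1, c + t.2) := by
  refine ModuleOrdering.lt_of_le_of_ne (ρ.mul_le _ _ c h.le) fun e => h ?_
  obtain ⟨i, a⟩ := s
  obtain ⟨j, b⟩ := t
  simp only [Prod.mk.injEq, add_right_inj] at e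
  obtain ⟨rfl, rfl⟩ := e
  exact ModuleOrdering.refl _

theorem ModuleOrdering.exists_max (ρ : ModuleOrdering ι r) (S : Finset (MTerm ι r))
    (hS : S.Nonempty) : ∃ t ∈ S, ∀ s ∈ S, ρ.le s t := by
  classical
  induction hS using Finset.Nonempty.cons_induction with
  | singleton a => exact ⟨a, by simp, by simp [ModuleOrdering.refl]⟩
  | cons a S _ _ ih =>
    obtain ⟨t, ht, hmax⟩ := ih
    rcases ρ.total a t with h | h
    · refine ⟨t, by simp [ht], ?_⟩
      simpa [h] using fun i b hs => hmax (i, b) hs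
    · refine ⟨a, by simp, ?_⟩
      simpa [ModuleOrdering.refl] using fun i b hs => ρ.trans _ _ _ (hmax (i, b) hs) h

end Ordering

/-! ### Coefficients and leading terms of vectors. -/

section Coefficients

variable {ι : Type*} {r : ℕ} {K : Type*} [Field K]

theorem vcoeff_add (u v : Vect ι r K) (t : MTerm ι r) :
    vcoeff (u + v) t = vcoeff u t + vcoeff v t := by simp [vcoeff]

theorem vcoeff_sub (u v : Vect ι r K) (t : MTerm ι r) :
    vcoeff (u - v) t = vcoeff u t - vcoeff v t := by simp [vcoeff]

@[simp] theorem vcoeff_zero (t : MTerm ι r) : vcoeff (0 : Vect ι r K) t = 0 := by simp [vcoeff]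

theorem vect_ext {u v : Vect ι r K} (h : ∀ t, vcoeff u t = vcoeff v t) : u = v := by
  funext i
  ext a
  exact h (i, a)

theorem vcoeff_monomial_smul (c : ι →₀ ℕ) (k : K) (v : Vect ι r K) (i : Fin r) (b : ι →₀ ℕ) :
    vcoeff (monomial c k • v) (i, c + b) = k * vcoeff v (i, b) := by
  simp [vcoeff, coeff_monomial_mul]

theorem exists_of_vcoeff_monomial_smul_ne_zero {c : ι →₀ ℕ} {k : K} {v : Vect ι r K}
    {t : MTerm ι r} (h : vcoeff (monomial c k • v) t ≠ 0) :
    ∃ s, t = (s.1, c + s.2) ∧ k ≠ 0 ∧ vcoeff v s ≠ 0 := by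
  classical
  obtain ⟨i, a⟩ := t
  simp only [vcoeff, Pi.smul_apply, smul_eq_mul, coeff_monomial_mul'] at h
  split_ifs at h with hc
  · obtain ⟨b, rfl⟩ := exists_add_of_le hc
    rw [add_tsub_cancel_left] at h
    exact ⟨(i, b), rfl, left_ne_zero_of_mul h, right_ne_zero_of_mul h⟩
  · exact absurd rfl h

variable {ρ : ModuleOrdering ι r}

theorem IsLeadingTerm.ne_zero {v : Vect ι r K} {t : MTerm ι r} (h : IsLeadingTerm ρ v t) :
    v ≠ 0 := by
  rintro rfl
  exact h.1 (vcoeff_zero t)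

theorem IsLeadingTerm.unique {v : Vect ι r K} {s t : MTerm ι r} (hs : IsLeadingTerm ρ v s)
    (ht : IsLeadingTerm ρ v t) : s = t :=
  ρ.antisymm _ _ (ht.2 _ hs.1) (hs.2 _ ht.1)

theorem exists_isLeadingTerm (ρ : ModuleOrdering ι r) {v : Vect ι r K} (hv : v ≠ 0) :
    ∃ t, IsLeadingTerm ρ v t := by
  classical
  let S : Finset (MTerm ι r) := Finset.univ.biUnion fun i => (v i).support.image fun a => (i, a)
  have hmem : ∀ t, t ∈ S ↔ vcoeff v t ≠ 0 := by
    rintro ⟨i, a⟩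
    simp [S, vcoeff]
  have hne : S.Nonempty := by
    by_contra hS
    refine hv (vect_ext fun t => ?_)
    by_contra ht
    exact hS ⟨t, (hmem t).2 (by simpa using ht)⟩
  obtain ⟨t, ht, hmax⟩ := ρ.exists_max S hne
  exact ⟨t, (hmem t).1 ht, fun s hs => hmax s ((hmem s).2 hs)⟩

theorem IsLeadingTerm.monomial_smul {v : Vect ι r K} {i : Fin r} {b : ι →₀ ℕ}
    (h : IsLeadingTerm ρ v (i, b)) (c : ι →₀ ℕ) {k : K} (hk : k ≠ 0) :
    IsLeadingTerm ρ (monomial c k • v) (i, c + b) := by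
  refine ⟨by rw [vcoeff_monomial_smul]; exact mul_ne_zero hk h.1, fun s hs => ?_⟩
  obtain ⟨s, rfl, -, hs⟩ := exists_of_vcoeff_monomial_smul_ne_zero hs
  exact ρ.mul_le _ _ c (h.2 s hs)

/-- The cancellation of top terms common to division steps and S-vectors. -/
theorem lt_of_vcoeff_sub_ne_zero {f g : Vect ι r K} {t : MTerm ι r}
    (hf : ∀ s, vcoeff f s ≠ 0 → ρ.le s t) (hg : ∀ s, vcoeff g s ≠ 0 → ρ.le s t)
    (h : vcoeff f t = vcoeff g t) (s : MTerm ι r) (hs : vcoeff (f - g) s ≠ 0) : ρ.lt s t := by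
  rw [vcoeff_sub] at hs
  refine ModuleOrdering.lt_of_le_of_ne ?_ ?_
  · by_cases hfs : vcoeff f s = 0
    · exact hg s fun hgs => hs (by rw [hfs, hgs, sub_zero])
    · exact hf s hfs
  · rintro rfl
    exact hs (sub_eq_zero.2 h)

theorem lt_of_vcoeff_reduce_ne_zero {f g : Vect ι r K} {i : Fin r} {b c : ι →₀ ℕ}
    (hf : IsLeadingTerm ρ f (i, c + b)) (hg : IsLeadingTerm ρ g (i, b)) (s : MTerm ι r)
    (hs : vcoeff (f - monomial c (vcoeff f (i, c + b) / vcoeff g (i, b)) • g) s ≠ 0) :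
    ρ.lt s (i, c + b) := by
  refine lt_of_vcoeff_sub_ne_zero hf.2 (hg.monomial_smul c (div_ne_zero hf.1 hg.1)).2 ?_ s hs
  rw [vcoeff_monomial_smul, div_mul_cancel₀ _ hg.1]

end Coefficients

/-! ### Bounded representations and Buchberger's criterion. -/

section Representations

variable {ι : Type*} {r : ℕ} {K : Type*} [Field K] {ρ : ModuleOrdering ι r}

/-- The vectors that are linear combinations of multiples `x^c g` of elements of `G` whose leading
terms satisfy `p`. -/
noncomputable def repSpan (ρ : ModuleOrdering ι r) (G : Set (Vect ι r K)) (p : MTerm ι r → Prop) :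
    Submodule K (Vect ι r K) :=
  Submodule.span K {m | ∃ g ∈ G, ∃ i b c, IsLeadingTerm ρ g (i, b) ∧ p (i, c + b) ∧
    m = monomial c (1 : K) • g}

theorem monomial_smul_eq (c : ι →₀ ℕ) (k : K) (v : Vect ι r K) :
    monomial c k • v = k • (monomial c (1 : K) • v) := by
  rw [← smul_assoc, smul_monomial, smul_eq_mul, mul_one]

theorem monomial_smul_mem_repSpan {G : Set (Vect ι r K)} {p : MTerm ι r → Prop} {g : Vect ι r K}
    (hg : g ∈ G) {i : Fin r} {b c : ι →₀ ℕ} (hl : IsLeadingTerm ρ g (i, b)) (hp : p (i, c + b))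
    (k : K) : monomial c k • g ∈ repSpan ρ G p := by
  rw [monomial_smul_eq]
  exact Submodule.smul_mem _ _ (Submodule.subset_span ⟨g, hg, i, b, c, hl, hp, rfl⟩)

theorem generator_mem_repSpan {G : Set (Vect ι r K)} {p : MTerm ι r → Prop} {g : Vect ι r K}
    (hg : g ∈ G) {i : Fin r} {b c : ι →₀ ℕ} (hl : IsLeadingTerm ρ g (i, b)) (hp : p (i, c + b)) :
    monomial c (1 : K) • g ∈ repSpan ρ G p :=
  Submodule.subset_span ⟨g, hg, i, b, c, hl, hp, rfl⟩

theorem repSpan_mono {G G' : Set (Vect ι r K)} {p p' : MTerm ι r → Prop} (hG : G ⊆ G')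
    (hp : ∀ t, p t → p' t) : repSpan ρ G p ≤ repSpan ρ G' p' := by
  refine Submodule.span_mono ?_
  rintro m ⟨g, hg, i, b, c, hl, h, rfl⟩
  exact ⟨g, hG hg, i, b, c, hl, hp _ h, rfl⟩

theorem mem_span_of_mem_repSpan {G : Set (Vect ι r K)} {p : MTerm ι r → Prop} {f : Vect ι r K}
    (hf : f ∈ repSpan ρ G p) : f ∈ Submodule.span (MvPolynomial ι K) G := by
  have : repSpan ρ G p ≤ (Submodule.span (MvPolynomial ι K) G).restrictScalars K := by
    refine Submodule.span_le.2 ?_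
    rintro m ⟨g, hg, i, b, c, -, -, rfl⟩
    exact Submodule.smul_mem _ _ (Submodule.subset_span hg)
  exact this hf

theorem monomial_smul_mem_repSpan_of_mem {G : Set (Vect ι r K)} {p p' : MTerm ι r → Prop}
    (c : ι →₀ ℕ) (hp : ∀ t, p t → p' (t.1, c + t.2)) (k : K) {f : Vect ι r K}
    (hf : f ∈ repSpan ρ G p) : monomial c k • f ∈ repSpan ρ G p' := by
  induction hf using Submodule.span_induction with
  | mem m hm =>
    obtain ⟨g, hg, i, b, d, hl, h, rfl⟩ := hm
    rw [← smul_assoc, smul_eq_mul, monomial_mul]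
    exact monomial_smul_mem_repSpan hg hl (by simpa [add_assoc] using hp _ h) _
  | zero => simp
  | add x y _ _ hx hy => rw [smul_add]; exact Submodule.add_mem _ hx hy
  | smul a x _ hx => rw [smul_comm]; exact Submodule.smul_mem _ _ hx

theorem mem_repSpan_of_mem_span {G : Set (Vect ι r K)} (hG : ∀ g ∈ G, g ≠ 0) {f : Vect ι r K}
    (hf : f ∈ Submodule.span (MvPolynomial ι K) G) : f ∈ repSpan ρ G fun _ => True := by
  induction hf using Submodule.span_induction with
  | mem g hg =>
    obtain ⟨⟨i, b⟩, hl⟩ := exists_isLeadingTerm ρ (hG g hg)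
    simpa using monomial_smul_mem_repSpan (p := fun _ => True) (c := 0) hg hl trivial 1
  | zero => exact zero_mem _
  | add x y _ _ hx hy => exact Submodule.add_mem _ hx hy
  | smul q x _ hx =>
    induction q using MvPolynomial.induction_on' with
    | monomial c k => exact monomial_smul_mem_repSpan_of_mem c (fun _ _ => trivial) k hx
    | add p q hp hq => rw [add_smul]; exact Submodule.add_mem _ hp hq

/-- A representation involves finitely many multiples, so one of their leading terms is largest.
This bound is the induction parameter in Buchberger's criterion. -/
theorem eq_zero_or_mem_repSpan_le {G : Set (Vect ι r K)} {p : MTerm ι r → Prop} {f : Vect ι r K}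
    (hf : f ∈ repSpan ρ G p) :
    f = 0 ∨ ∃ t, p t ∧ f ∈ repSpan ρ G (ρ.le · t) := by
  induction hf using Submodule.span_induction with
  | mem m hm =>
    obtain ⟨g, hg, i, b, c, hl, h, rfl⟩ := hm
    exact Or.inr ⟨_, h, generator_mem_repSpan (p := (ρ.le · (i, c + b))) hg hl
      (ModuleOrdering.refl _)⟩
  | zero => exact Or.inl rfl
  | add x y _ _ hx hy =>
    rcases hx with rfl | ⟨t, ht, hx⟩
    · rwa [zero_add]
    rcases hy with rfl | ⟨u, hu, hy⟩
    · rw [add_zero]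
      exact Or.inr ⟨t, ht, hx⟩
    rcases ρ.total t u with h | h
    · have hx' : x ∈ repSpan ρ G (ρ.le · u) :=
        repSpan_mono subset_rfl (fun s hs => ρ.trans _ _ _ hs h) hx
      exact Or.inr ⟨u, hu, Submodule.add_mem _ hx' hy⟩
    · have hy' : y ∈ repSpan ρ G (ρ.le · t) :=
        repSpan_mono subset_rfl (fun s hs => ρ.trans _ _ _ hs h) hy
      exact Or.inr ⟨t, ht, Submodule.add_mem _ hx hy'⟩
  | smul a x _ hx =>
    rcases hx with rfl | ⟨t, ht, hx⟩
    · exact Or.inl (smul_zero _)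
    · exact Or.inr ⟨t, ht, Submodule.smul_mem _ _ hx⟩

theorem vcoeff_ne_zero_of_mem_repSpan {G : Set (Vect ι r K)} {p : MTerm ι r → Prop}
    (hp : ∀ s t, ρ.le s t → p t → p s) {f : Vect ι r K} (hf : f ∈ repSpan ρ G p)
    (s : MTerm ι r) (hs : vcoeff f s ≠ 0) : p s := by
  induction hf using Submodule.span_induction with
  | mem m hm =>
    obtain ⟨g, hg, i, b, c, hl, h, rfl⟩ := hm
    exact hp _ _ ((hl.monomial_smul c one_ne_zero).2 s hs) h
  | zero => exact absurd (vcoeff_zero s) hs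
  | add x y _ _ hx hy =>
    by_cases h : vcoeff x s = 0
    · exact hy (by rwa [vcoeff_add, h, zero_add] at hs)
    · exact hx h
  | smul a x _ hx =>
    refine hx fun h => hs ?_
    simp only [vcoeff] at h
    simp [vcoeff, h]

/-- The S-vector of `u` and `v` for the leading terms `x^a e_i` and `x^b e_i`. -/
noncomputable def sVector (u v : Vect ι r K) (i : Fin r) (a b : ι →₀ ℕ) : Vect ι r K :=
  monomial (a ⊔ b - a) (vcoeff u (i, a))⁻¹ • u - monomial (a ⊔ b - b) (vcoeff v (i, b))⁻¹ • v

theorem sVector_swap (u v : Vect ι r K) (i : Fin r) (a b : ι →₀ ℕ) :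
    sVector u v i a b = -sVector v u i b a := by
  rw [sVector, sVector, neg_sub, sup_comm]

theorem sVector_self (u : Vect ι r K) (i : Fin r) (a : ι →₀ ℕ) : sVector u u i a a = 0 :=
  sub_self _

theorem lt_of_vcoeff_sVector_ne_zero {u v : Vect ι r K} {i : Fin r} {a b : ι →₀ ℕ}
    (hu : IsLeadingTerm ρ u (i, a)) (hv : IsLeadingTerm ρ v (i, b)) (s : MTerm ι r)
    (hs : vcoeff (sVector u v i a b) s ≠ 0) : ρ.lt s (i, a ⊔ b) := by
  have h1 : a ⊔ b - a + a = a ⊔ b := tsub_add_cancel_of_le le_sup_left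
  have h2 : a ⊔ b - b + b = a ⊔ b := tsub_add_cancel_of_le le_sup_right
  have hu' := hu.monomial_smul (a ⊔ b - a) (inv_ne_zero hu.1)
  have hv' := hv.monomial_smul (a ⊔ b - b) (inv_ne_zero hv.1)
  have e1 := vcoeff_monomial_smul (a ⊔ b - a) (vcoeff u (i, a))⁻¹ u i a
  have e2 := vcoeff_monomial_smul (a ⊔ b - b) (vcoeff v (i, b))⁻¹ v i b
  rw [h1] at hu' e1
  rw [h2] at hv' e2
  refine lt_of_vcoeff_sub_ne_zero hu'.2 hv'.2 ?_ s hs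
  rw [e1, e2, inv_mul_cancel₀ hu.1, inv_mul_cancel₀ hv.1]

theorem monomial_smul_sVector {u v : Vect ι r K} {i : Fin r} {a b c d : ι →₀ ℕ}
    (h : c + a = d + b) :
    monomial (c + a - a ⊔ b) (1 : K) • sVector u v i a b =
      monomial c (vcoeff u (i, a))⁻¹ • u - monomial d (vcoeff v (i, b))⁻¹ • v := by
  have hle : a ⊔ b ≤ c + a := sup_le le_add_self (h ▸ le_add_self)
  have hc : c + a - a ⊔ b + (a ⊔ b - a) = c := by
    rw [tsub_add_tsub_cancel hle le_sup_left, add_tsub_cancel_right]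
  have hd : c + a - a ⊔ b + (a ⊔ b - b) = d := by
    rw [tsub_add_tsub_cancel hle le_sup_right, h, add_tsub_cancel_right]
  rw [sVector, smul_sub, ← smul_assoc, ← smul_assoc, smul_eq_mul, smul_eq_mul, monomial_mul,
    monomial_mul, hc, hd, one_mul, one_mul]

/-- Every S-vector of elements of `G` has a representation by `G` whose terms lie below the least
common multiple of the leading terms. -/
def SVectorsReduce (ρ : ModuleOrdering ι r) (G : Set (Vect ι r K)) (u v : Vect ι r K) : Prop :=
  ∀ i a b, IsLeadingTerm ρ u (i, a) → IsLeadingTerm ρ v (i, b) →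
    sVector u v i a b ∈ repSpan ρ G (ρ.lt · (i, a ⊔ b))

theorem SVectorsReduce.symm {G : Set (Vect ι r K)} {u v : Vect ι r K}
    (h : SVectorsReduce ρ G u v) : SVectorsReduce ρ G v u := by
  intro i a b ha hb
  rw [sVector_swap, sup_comm]
  exact Submodule.neg_mem _ (h i b a hb ha)

theorem SVectorsReduce.self {G : Set (Vect ι r K)} {u : Vect ι r K} :
    SVectorsReduce ρ G u u := by
  intro i a b ha hb
  obtain rfl : a = b := by simpa using ha.unique hb
  rw [sVector_self]
  exact zero_mem _

theorem SVectorsReduce.mono {G G' : Set (Vect ι r K)} {u v : Vect ι r K} (hG : G ⊆ G')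
    (h : SVectorsReduce ρ G u v) : SVectorsReduce ρ G' u v :=
  fun i a b ha hb => repSpan_mono hG (fun _ => id) (h i a b ha hb)

/-- Any multiple x^d g whose leading term attains the bound differs from a scalar multiple of x^c u
by a monomial multiple of an S-vector, which is represented strictly below. So modulo lower
representations the top layer is one-dimensional, spanned by x^c u. -/
theorem exists_smul_add_of_mem_repSpan_le {G : Set (Vect ι r K)}
    (hS : ∀ u ∈ G, ∀ v ∈ G, SVectorsReduce ρ G u v) {u : Vect ι r K} (hu : u ∈ G) {i : Fin r}
    {a c : ι →₀ ℕ} (hl : IsLeadingTerm ρ u (i, a)) {f : Vect ι r K}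
    (hf : f ∈ repSpan ρ G (ρ.le · (i, c + a))) :
    ∃ k : K, f - monomial c k • u ∈ repSpan ρ G (ρ.lt · (i, c + a)) := by
  induction hf using Submodule.span_induction with
  | mem m hm =>
    obtain ⟨g, hg, j, b, d, hlg, h, rfl⟩ := hm
    by_cases he : (j, d + b) = (i, c + a)
    · simp only [Prod.mk.injEq] at he
      obtain ⟨rfl, he⟩ := he
      refine ⟨vcoeff g (j, b) / vcoeff u (j, a), ?_⟩
      have key : monomial (d + b - b ⊔ a) (1 : K) • sVector g u j b a ∈
          repSpan ρ G (ρ.lt · (j, c + a)) := by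
        refine monomial_smul_mem_repSpan_of_mem _ (fun t ht => ?_) _ (hS g hg u hu j b a hlg hl)
        have := ModuleOrdering.mul_lt (d + b - b ⊔ a) ht
        dsimp only at this
        rwa [tsub_add_cancel_of_le (sup_le le_add_self (he ▸ le_add_self)),
          show (j, d + b) = (j, c + a) by rw [he]] at this
      rw [monomial_smul_sVector he] at key
      have := Submodule.smul_mem _ (vcoeff g (j, b)) key
      rw [smul_sub, ← smul_assoc, ← smul_assoc, smul_monomial, smul_monomial, smul_eq_mul,
        smul_eq_mul, mul_inv_cancel₀ hlg.1] at this
      rwa [div_eq_mul_inv]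
    · refine ⟨0, ?_⟩
      rw [map_zero, zero_smul, sub_zero]
      exact generator_mem_repSpan (p := (ρ.lt · (i, c + a))) hg hlg
        (ModuleOrdering.lt_of_le_of_ne h he)
  | zero => exact ⟨0, by simp⟩
  | add x y _ _ hx hy =>
    obtain ⟨k, hx⟩ := hx
    obtain ⟨l, hy⟩ := hy
    refine ⟨k + l, ?_⟩
    rw [map_add, add_smul, add_sub_add_comm]
    exact Submodule.add_mem _ hx hy
  | smul l x _ hx =>
    obtain ⟨k, hx⟩ := hx
    refine ⟨l * k, ?_⟩
    rw [← smul_eq_mul, ← smul_monomial, smul_assoc, ← smul_sub]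
    exact Submodule.smul_mem _ _ hx

/-- The leading term of `f` is a multiple of the leading term of an element of `G`. -/
def LeadDivisible (ρ : ModuleOrdering ι r) (G : Set (Vect ι r K)) (t : MTerm ι r) : Prop :=
  ∃ g ∈ G, ∃ b, IsLeadingTerm ρ g (t.1, b) ∧ b ≤ t.2

/-- Well-founded induction on the bound t of the representation: either t is the leading term of f
and is attained by a multiple of some g, or the bound can be lowered. -/
theorem leadDivisible_of_mem_repSpan_le (hwf : WellFounded ρ.lt) {G : Set (Vect ι r K)}
    (hS : ∀ u ∈ G, ∀ v ∈ G, SVectorsReduce ρ G u v) (t : MTerm ι r) :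
    ∀ f ∈ repSpan ρ G (ρ.le · t), ∀ s, IsLeadingTerm ρ f s → LeadDivisible ρ G s := by
  induction t using hwf.induction with
  | _ t ih =>
    intro f hf s hs
    have step : f ∈ repSpan ρ G (ρ.lt · t) → LeadDivisible ρ G s := by
      intro hf'
      obtain rfl | ⟨t', ht', hf'⟩ := eq_zero_or_mem_repSpan_le hf'
      · exact absurd rfl hs.ne_zero
      · exact ih t' ht' f hf' s hs
    by_cases ht : LeadDivisible ρ G t
    · obtain ⟨i, e⟩ := t
      obtain ⟨g, hg, b, hl, hb⟩ := ht
      obtain ⟨c, rfl⟩ := exists_add_of_le hb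
      dsimp only at hl hb
      rw [add_comm b c] at *
      obtain ⟨k, hk⟩ := exists_smul_add_of_mem_repSpan_le hS hg hl hf
      -- The scalar k decides: for k = 0 the bound drops, and for k ≠ 0 the term t survives in f and
      -- is its leading term.
      by_cases h0 : k = 0
      · subst h0
        rw [map_zero, zero_smul, sub_zero] at hk
        exact step hk
      · have hlt := vcoeff_ne_zero_of_mem_repSpan
          (fun _ _ h h' => ModuleOrdering.lt_of_le_of_lt h h') hk
        have hle := vcoeff_ne_zero_of_mem_repSpan (fun _ _ h h' => ρ.trans _ _ _ h h') hf
        have hc : vcoeff f (i, c + b) ≠ 0 := by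
          intro h0'
          refine hlt (i, c + b) ?_ (ModuleOrdering.refl _)
          rw [vcoeff_sub, h0', vcoeff_monomial_smul, zero_sub]
          exact neg_ne_zero.2 (mul_ne_zero h0 hl.1)
        obtain rfl : s = (i, c + b) := ρ.antisymm _ _ (hle s hs.1) (hs.2 _ hc)
        exact ⟨g, hg, b, hl, hb⟩
    -- No multiple of a member of G has leading term t, so the bound is automatically strict.
    · refine step ?_
      refine (Submodule.span_le.2 ?_ : repSpan ρ G (ρ.le · t) ≤ _) hf
      rintro m ⟨g, hg, i, b, c, hl, h, rfl⟩
      refine generator_mem_repSpan (p := (ρ.lt · t)) hg hl (ModuleOrdering.lt_of_le_of_ne h ?_)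
      rintro rfl
      exact ht ⟨g, hg, b, hl, le_add_self⟩

/-- Buchberger's criterion. -/
theorem leadDivisible_of_mem_span (hwf : WellFounded ρ.lt) {G : Set (Vect ι r K)}
    (hG : ∀ g ∈ G, g ≠ 0) (hS : ∀ u ∈ G, ∀ v ∈ G, SVectorsReduce ρ G u v) {f : Vect ι r K}
    (hf : f ∈ Submodule.span (MvPolynomial ι K) G) {s : MTerm ι r} (hs : IsLeadingTerm ρ f s) :
    LeadDivisible ρ G s := by
  obtain rfl | ⟨t, -, ht⟩ := eq_zero_or_mem_repSpan_le (mem_repSpan_of_mem_span (ρ := ρ) hG hf)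
  · exact absurd rfl hs.ne_zero
  · exact leadDivisible_of_mem_repSpan_le hwf hS t f ht s hs

/-- Generation comes for free: cancelling leading terms by elements of G stays inside N and must
stop at zero, since ρ is well-founded. -/
theorem isGroebnerBasis_of_leadDivisible (hwf : WellFounded ρ.lt) {G : Set (Vect ι r K)}
    {N : Submodule (MvPolynomial ι K) (Vect ι r K)} (hG : ∀ g ∈ G, g ≠ 0) (hGN : ∀ g ∈ G, g ∈ N)
    (h : ∀ f ∈ N, ∀ t, IsLeadingTerm ρ f t → LeadDivisible ρ G t) : IsGroebnerBasis ρ G N := by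
  refine ⟨hG, le_antisymm (Submodule.span_le.2 hGN) ?_, le_antisymm ?_ ?_⟩
  · have main : ∀ t, ∀ f ∈ N, IsLeadingTerm ρ f t → f ∈ Submodule.span (MvPolynomial ι K) G := by
      intro t
      induction t using hwf.induction with
      | _ t ih =>
        intro f hf hl
        obtain ⟨g, hg, b, hlg, hb⟩ := h f hf t hl
        obtain ⟨i, e⟩ := t
        obtain ⟨c, rfl⟩ := exists_add_of_le hb
        dsimp only at hlg hb
        rw [add_comm b c] at *
        have hlt := lt_of_vcoeff_reduce_ne_zero hl hlg
        set q := monomial c (vcoeff f (i, c + b) / vcoeff g (i, b)) • g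
        have hq : q ∈ Submodule.span (MvPolynomial ι K) G :=
          Submodule.smul_mem _ _ (Submodule.subset_span hg)
        have hqN : q ∈ N := Submodule.smul_mem _ _ (hGN g hg)
        rw [← sub_add_cancel f q]
        refine Submodule.add_mem _ ?_ hq
        by_cases h0 : f - q = 0
        · rw [h0]
          exact zero_mem _
        · obtain ⟨s, hs⟩ := exists_isLeadingTerm ρ h0
          exact ih s (hlt s hs.1) _ (Submodule.sub_mem _ hf hqN) hs
    intro f hf
    by_cases h0 : f = 0
    · rw [h0]
      exact zero_mem _
    · obtain ⟨t, ht⟩ := exists_isLeadingTerm ρ h0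
      exact main t f hf ht
  · refine Submodule.span_le.2 ?_
    rintro m ⟨f, hf, ⟨i, e⟩, hl, rfl⟩
    obtain ⟨g, hg, b, hlg, hb⟩ := h f hf _ hl
    obtain ⟨c, rfl⟩ := exists_add_of_le hb
    have : (Pi.single i (monomial (b + c) 1) : Vect ι r K) =
        (monomial c (1 : K)) • Pi.single i (monomial b 1) := by
      rw [← Pi.single_smul, smul_eq_mul, monomial_mul, one_mul, add_comm]
    dsimp only
    rw [SetLike.mem_coe, this]
    exact Submodule.smul_mem _ _ (Submodule.subset_span ⟨g, hg, _, hlg, rfl⟩)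
  · refine Submodule.span_mono ?_
    rintro m ⟨g, hg, t, hl, rfl⟩
    exact ⟨g, hGN g hg, t, hl, rfl⟩

end Representations

/-! ### The division algorithm. -/

section Division

variable {ι : Type*} {r : ℕ} {K : Type*} [Field K] {ρ : ModuleOrdering ι r}

theorem exists_isRemainder (hwf : WellFounded ρ.lt) (G : List (Vect ι r K)) (w : Vect ι r K) :
    ∃ R, IsRemainder ρ w G R := by
  have hzero : ∃ R, IsRemainder ρ (0 : Vect ι r K) G R :=
    ⟨0, .refl, fun _ _ _ _ _ h => absurd rfl h.ne_zero⟩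
  have main : ∀ t, ∀ w : Vect ι r K, IsLeadingTerm ρ w t → ∃ R, IsRemainder ρ w G R := by
    intro t
    induction t using hwf.induction with
    | _ t ih =>
      intro w hl
      by_cases h : ∃ g ∈ G, ∃ i b c, IsLeadingTerm ρ g (i, b) ∧ t = (i, c + b)
      · obtain ⟨g, hg, i, b, c, hlg, rfl⟩ := h
        have hlt := lt_of_vcoeff_reduce_ne_zero hl hlg
        have hstep : ReducesTo ρ G w _ := ⟨g, hg, i, b, c, hlg, hl.1, rfl⟩
        set w' := w - monomial c (vcoeff w (i, c + b) / vcoeff g (i, b)) • g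
        have : ∃ R, IsRemainder ρ w' G R := by
          by_cases h0 : w' = 0
          · rwa [h0]
          · obtain ⟨s, hs⟩ := exists_isLeadingTerm ρ h0
            exact ih s (hlt s hs.1) w' hs
        obtain ⟨R, hR, hR'⟩ := this
        exact ⟨R, .head hstep hR, hR'⟩
      · refine ⟨w, .refl, fun g hg i a b ha hb hle => h ?_⟩
        obtain ⟨c, rfl⟩ := exists_add_of_le hle
        exact ⟨g, hg, i, b, c, hb, by rw [hl.unique ha, add_comm]⟩
  by_cases h0 : w = 0
  · rwa [h0]
  · obtain ⟨t, ht⟩ := exists_isLeadingTerm ρ h0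
    exact main t w ht

/-- A division step subtracts a multiple whose leading term occurs in the current vector, so no term
outside the down-set p is ever created. -/
theorem reduction_mem_repSpan {G : List (Vect ι r K)} {p : MTerm ι r → Prop}
    (hp : ∀ s t, ρ.le s t → p t → p s) {w R : Vect ι r K}
    (h : Relation.ReflTransGen (ReducesTo ρ G) w R) (hw : ∀ s, vcoeff w s ≠ 0 → p s) :
    (∀ s, vcoeff R s ≠ 0 → p s) ∧ w - R ∈ repSpan ρ {g | g ∈ G} p := by
  induction h with
  | refl => exact ⟨hw, by rw [sub_self]; exact zero_mem _⟩
  | @tail v _ _ hstep ih =>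
    obtain ⟨g, hg, i, b, c, hl, hc, rfl⟩ := hstep
    have hq := fun k : K => monomial_smul_mem_repSpan (G := {g | g ∈ G}) hg hl (ih.1 _ hc) k
    refine ⟨fun s hs => ?_, ?_⟩
    · rw [vcoeff_sub] at hs
      by_cases h0 : vcoeff v s = 0
      · rw [h0, zero_sub, neg_ne_zero] at hs
        exact vcoeff_ne_zero_of_mem_repSpan hp (hq _) s hs
      · exact ih.1 s h0
    · rw [sub_sub_eq_add_sub, add_sub_right_comm]
      exact Submodule.add_mem _ ih.2 (hq _)

end Division

/-! ### Dickson's lemma and well-foundedness of the extended ordering. -/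

/-- Dickson's lemma for the terms of a free module. -/
theorem wellQuasiOrdered_mterm (ι : Type*) [Finite ι] (r : ℕ) :
    WellQuasiOrdered fun s t : MTerm ι r => s.1 = t.1 ∧ s.2 ≤ t.2 :=
  (Finite.wellQuasiOrdered (· = ·)).prod wellQuasiOrdered_le

/-- Such an ordering extends divisibility, so it inherits the well-quasi-order property from
Dickson's lemma. -/
theorem wellFounded_lt_of_le_mul {ι : Type*} [Finite ι] {r : ℕ} {ρ : ModuleOrdering ι r}
    (h : ∀ (t : MTerm ι r) c, ρ.le t (t.1, c + t.2)) : WellFounded ρ.lt := by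
  have : IsPreorder _ ρ.le :=
    { refl := ModuleOrdering.refl
      trans := ρ.trans }
  have hwqo : WellQuasiOrdered ρ.le := by
    intro f
    obtain ⟨m, n, hmn, h1, h2⟩ := wellQuasiOrdered_mterm ι r f
    refine ⟨m, n, hmn, ?_⟩
    obtain ⟨c, hc⟩ := exists_add_of_le h2
    have := h (f m) c
    rwa [add_comm, ← hc, h1] at this
  exact Subrelation.wf (fun {_ _} hst => ⟨hst.le, hst⟩) hwqo.wellFounded

section Weights

variable {n r : ℕ} {W : Fin n → ℤ}

theorem weight_nonneg (hW : ∀ j, 0 < W j) (a : Fin n →₀ ℕ) : 0 ≤ Finsupp.weight W a := by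
  rw [Finsupp.weight_apply]
  exact Finset.sum_nonneg fun i _ => nsmul_nonneg (hW i).le _

theorem eq_zero_of_weight_eq_zero (hW : ∀ j, 0 < W j) {a : Fin n →₀ ℕ}
    (h : Finsupp.weight W a = 0) : a = 0 := by
  rw [Finsupp.weight_apply, Finsupp.sum,
    Finset.sum_eq_zero_iff_of_nonneg fun i _ => nsmul_nonneg (hW i).le _] at h
  ext j
  by_contra hj
  have := h j (Finsupp.mem_support_iff.2 hj)
  rw [nsmul_eq_mul, mul_eq_zero] at this
  rcases this with h0 | h0
  · exact hj (by exact_mod_cast h0)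
  · exact (hW j).ne' h0

/-- Every variable has positive degree, so a nontrivial factor raises the degree, and σ̄ looks at
the degree first. Nothing is asked of σ itself. -/
theorem extend_le_mul (hW : ∀ j, 0 < W j) (δ : Fin r → ℤ) (σ : ModuleOrdering (Fin n) r)
    (t : MTerm (Option (Fin n)) r) (c : Option (Fin n) →₀ ℕ) :
    (σ.extend W δ).le t (t.1, c + t.2) := by
  have h0 := weight_nonneg hW c.some
  have hd := degBar_add W δ t c
  rcases lt_or_eq_of_le (show degBar W δ t ≤ degBar W δ (t.1, c + t.2) by omega) with h | h
  · exact Or.inl h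
  · have hc : c = 0 := by
      have hs : c.some = 0 := eq_zero_of_weight_eq_zero hW (by omega)
      ext o
      cases o with
      | none => simp only [Finsupp.coe_zero, Pi.zero_apply]; omega
      | some j => simpa using DFunLike.congr_fun hs j
    rw [hc, zero_add]
    exact ModuleOrdering.refl _

theorem wellFounded_extend_lt (hW : ∀ j, 0 < W j) (δ : Fin r → ℤ) (σ : ModuleOrdering (Fin n) r) :
    WellFounded (σ.extend W δ).lt :=
  wellFounded_lt_of_le_mul (extend_le_mul hW δ σ)

end Weights

/-! ### Homogenization, dehomogenization and saturation. -/

section Homogeneous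

variable {n r : ℕ} {K : Type*} [Field K] {W : Fin n → ℤ} {δ : Fin r → ℤ}

/-- All terms of `V` have degree `d`. -/
def HasDegree (W : Fin n → ℤ) (δ : Fin r → ℤ) (d : ℤ) (V : Vect (Option (Fin n)) r K) : Prop :=
  ∀ t, vcoeff V t ≠ 0 → degBar W δ t = d

theorem HasDegree.zero (d : ℤ) : HasDegree W δ d (0 : Vect (Option (Fin n)) r K) :=
  fun t ht => absurd (vcoeff_zero t) ht

theorem HasDegree.add {d : ℤ} {U V : Vect (Option (Fin n)) r K} (hU : HasDegree W δ d U)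
    (hV : HasDegree W δ d V) : HasDegree W δ d (U + V) := by
  intro t ht
  by_cases h : vcoeff U t = 0
  · exact hV t (by rwa [vcoeff_add, h, zero_add] at ht)
  · exact hU t h

theorem HasDegree.sub {d : ℤ} {U V : Vect (Option (Fin n)) r K} (hU : HasDegree W δ d U)
    (hV : HasDegree W δ d V) : HasDegree W δ d (U - V) := by
  intro t ht
  by_cases h : vcoeff U t = 0
  · exact hV t fun h' => ht (by rw [vcoeff_sub, h, h', sub_zero])
  · exact hU t h

theorem HasDegree.monomial_smul {d : ℤ} {V : Vect (Option (Fin n)) r K} (hV : HasDegree W δ d V)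
    (c : Option (Fin n) →₀ ℕ) (k : K) :
    HasDegree W δ (c none + Finsupp.weight W c.some + d) (monomial c k • V) := by
  intro t ht
  obtain ⟨s, rfl, -, hs⟩ := exists_of_vcoeff_monomial_smul_ne_zero ht
  rw [degBar_add, hV s hs]

theorem HasDegree.monomial_smul_of_term {d : ℤ} {V : Vect (Option (Fin n)) r K} {i : Fin r}
    {b : Option (Fin n) →₀ ℕ} (hV : IsHomogeneousVec W δ V) (hb : vcoeff V (i, b) ≠ 0)
    {c : Option (Fin n) →₀ ℕ} (k : K) (hd : degBar W δ (i, c + b) = d) :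
    HasDegree W δ d (monomial c k • V) := by
  obtain ⟨e, he⟩ := hV
  have h := HasDegree.monomial_smul (W := W) (δ := δ) (d := e) he c k
  rwa [← he _ hb, ← degBar_add, hd] at h

theorem deg_le_topDeg {v : Vect (Fin n) r K} {t : MTerm (Fin n) r} (ht : vcoeff v t ≠ 0) :
    deg W δ t ≤ topDeg W δ v := by
  have h : ((deg W δ t : ℤ) : WithBot ℤ) ≤
      Finset.univ.sup fun i => (v i).support.sup fun a => ((deg W δ (i, a) : ℤ) : WithBot ℤ) :=
    le_trans (Finset.le_sup (f := fun a => ((deg W δ (t.1, a) : ℤ) : WithBot ℤ))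
      (mem_support_iff.2 ht))
      (Finset.le_sup (f := fun i => (v i).support.sup fun a => ((deg W δ (i, a) : ℤ) : WithBot ℤ))
        (Finset.mem_univ t.1))
  unfold topDeg
  generalize (Finset.univ.sup fun i => (v i).support.sup
    fun a => ((deg W δ (i, a) : ℤ) : WithBot ℤ)) = m at h
  induction m using WithBot.recBotCoe with
  | bot => simp at h
  | coe m => simpa using h

theorem exists_deg_eq_topDeg {v : Vect (Fin n) r K} (hv : v ≠ 0) :
    ∃ t, vcoeff v t ≠ 0 ∧ deg W δ t = topDeg W δ v := by
  obtain ⟨i, hi⟩ := Function.ne_iff.1 hv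
  have hu : (Finset.univ : Finset (Fin r)).Nonempty := ⟨i, Finset.mem_univ i⟩
  obtain ⟨j, -, hj⟩ := Finset.exists_mem_eq_sup Finset.univ hu
    fun i => (v i).support.sup fun a => ((deg W δ (i, a) : ℤ) : WithBot ℤ)
  have hj0 : (v j).support.Nonempty := by
    rw [Finset.nonempty_iff_ne_empty]
    intro h0
    rw [h0, Finset.sup_empty, Finset.sup_eq_bot_iff] at hj
    have h1 := hj i (Finset.mem_univ i)
    obtain ⟨a, ha⟩ := MvPolynomial.support_nonempty.2 hi
    rw [Finset.sup_eq_bot_iff] at h1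
    exact WithBot.coe_ne_bot (h1 a ha)
  obtain ⟨a, ha, ha'⟩ := Finset.exists_mem_eq_sup (v j).support hj0
    fun a => ((deg W δ (j, a) : ℤ) : WithBot ℤ)
  refine ⟨(j, a), mem_support_iff.1 ha, ?_⟩
  rw [topDeg, hj, ha', WithBot.unbotD_coe]

theorem vcoeff_hom (v : Vect (Fin n) r K) (t : MTerm (Option (Fin n)) r) :
    vcoeff (hom W δ v) t = if degBar W δ t = topDeg W δ v then vcoeff v (dehTerm t) else 0 := by
  classical
  obtain ⟨i, b⟩ := t
  -- On the support the exponent of y is a non-negative integer, so `toNat` truncates nothing.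
  have key : ∀ a ∈ (v i).support,
      (a.optionElim (topDeg W δ v - deg W δ (i, a)).toNat = b ↔
        degBar W δ (i, b) = topDeg W δ v ∧ a = b.some) := by
    intro a ha
    have hle : deg W δ (i, a) ≤ topDeg W δ v := deg_le_topDeg (t := (i, a)) (mem_support_iff.1 ha)
    constructor
    · rintro rfl
      simp only [degBar, dehTerm, Finsupp.some_optionElim, Finsupp.optionElim_apply_none, and_true]
      omega
    · rintro ⟨h, rfl⟩
      simp only [degBar, dehTerm] at h
      rw [show (topDeg W δ v - deg W δ (i, b.some)).toNat = b none by omega,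
        Finsupp.optionElim_some]
  simp only [vcoeff, hom, coeff_sum, coeff_monomial, dehTerm]
  rw [Finset.sum_congr rfl fun a ha => if_congr (key a ha) rfl rfl]
  split_ifs with h
  · simp only [h, true_and, Finset.sum_ite_eq']
    split_ifs with h'
    · rfl
    · exact (notMem_support_iff.1 h').symm
  · simp [h]

theorem hasDegree_hom (v : Vect (Fin n) r K) : HasDegree W δ (topDeg W δ v) (hom W δ v) := by
  intro t ht
  by_contra h
  exact ht (by rw [vcoeff_hom, if_neg h])

theorem aeval_elim_monomial (c : Option (Fin n) →₀ ℕ) (k : K) :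
    aeval (fun o : Option (Fin n) => o.elim (1 : MvPolynomial (Fin n) K) X) (monomial c k) =
      monomial c.some k := by
  rw [aeval_monomial, Finsupp.prod_option_index _ _ (by simp) (by intros; rw [pow_add]),
    monomial_eq (s := c.some)]
  simp [algebraMap_eq]

theorem deh_zero : deh (0 : Vect (Option (Fin n)) r K) = 0 := by
  funext i
  simp [deh]

theorem deh_add (U V : Vect (Option (Fin n)) r K) : deh (U + V) = deh U + deh V := by
  funext i
  simp [deh]

theorem deh_sub (U V : Vect (Option (Fin n)) r K) : deh (U - V) = deh U - deh V := by
  funext i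
  simp [deh]

theorem deh_monomial_smul (c : Option (Fin n) →₀ ℕ) (k : K) (V : Vect (Option (Fin n)) r K) :
    deh (monomial c k • V) = monomial c.some k • deh V := by
  funext i
  simp only [deh, Pi.smul_apply, smul_eq_mul, map_mul, aeval_elim_monomial]

theorem vcoeff_deh (V : Vect (Option (Fin n)) r K) (t : MTerm (Fin n) r) :
    vcoeff (deh V) t =
      ∑ b ∈ (V t.1).support, if b.some = t.2 then vcoeff V (t.1, b) else 0 := by
  classical
  simp only [vcoeff, deh]
  conv_lhs => rw [(V t.1).as_sum]
  simp only [map_sum, aeval_elim_monomial, coeff_sum, coeff_monomial]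

theorem exists_of_vcoeff_deh_ne_zero {V : Vect (Option (Fin n)) r K} {s : MTerm (Fin n) r}
    (h : vcoeff (deh V) s ≠ 0) : ∃ t, dehTerm t = s ∧ vcoeff V t ≠ 0 := by
  rw [vcoeff_deh] at h
  obtain ⟨b, hb, hb'⟩ := Finset.exists_ne_zero_of_sum_ne_zero h
  split_ifs at hb' with hs
  · exact ⟨(s.1, b), Prod.ext rfl hs, hb'⟩
  · exact absurd rfl hb'

theorem HasDegree.vcoeff_deh {d : ℤ} {V : Vect (Option (Fin n)) r K} (hV : HasDegree W δ d V)
    {t : MTerm (Option (Fin n)) r} (ht : degBar W δ t = d) :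
    vcoeff (deh V) (dehTerm t) = vcoeff V t := by
  rw [SelfSat.vcoeff_deh, Finset.sum_eq_single t.2]
  · exact if_pos rfl
  · intro b hb hne
    refine if_neg fun hs => hne ?_
    have := eq_of_degBar_eq W δ (t.1, b) t
      ((hV (t.1, b) (mem_support_iff.1 hb)).trans ht.symm) (Prod.ext rfl hs)
    rw [← this]
  · intro h
    rw [ite_eq_right_iff]
    exact fun _ => notMem_support_iff.1 h

/-- In a fixed degree the exponent of y is determined by the rest of the term, so putting y = 1
loses nothing. -/
theorem HasDegree.eq_of_deh_eq {d : ℤ} {U V : Vect (Option (Fin n)) r K}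
    (hU : HasDegree W δ d U) (hV : HasDegree W δ d V) (h : deh U = deh V) : U = V := by
  refine vect_ext fun t => ?_
  by_cases ht : degBar W δ t = d
  · rw [← hU.vcoeff_deh ht, ← hV.vcoeff_deh ht, h]
  · have h1 : vcoeff U t = 0 := by
      by_contra h1
      exact ht (hU t h1)
    have h2 : vcoeff V t = 0 := by
      by_contra h2
      exact ht (hV t h2)
    rw [h1, h2]

theorem exists_degBar_eq_topDeg {v : Vect (Fin n) r K} {s : MTerm (Fin n) r}
    (hs : vcoeff v s ≠ 0) : ∃ t : MTerm (Option (Fin n)) r, dehTerm t = s ∧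
      degBar W δ t = topDeg W δ v ∧ t.2 none = (topDeg W δ v - deg W δ s).toNat := by
  have hle : deg W δ s ≤ topDeg W δ v := deg_le_topDeg hs
  refine ⟨(s.1, s.2.optionElim (topDeg W δ v - deg W δ s).toNat), ?_, ?_, ?_⟩
  · simp [dehTerm]
  · simp only [degBar, dehTerm, Finsupp.some_optionElim, Finsupp.optionElim_apply_none]
    rw [Prod.mk.eta]
    omega
  · simp

theorem deh_hom (v : Vect (Fin n) r K) : deh (hom W δ v) = v := by
  refine vect_ext fun s => ?_
  by_cases hs : vcoeff v s = 0
  · by_contra h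
    rw [hs] at h
    obtain ⟨t, rfl, ht⟩ := exists_of_vcoeff_deh_ne_zero h
    rw [vcoeff_hom, hs, ite_self] at ht
    exact ht rfl
  · obtain ⟨t, rfl, ht, -⟩ := exists_degBar_eq_topDeg (W := W) (δ := δ) hs
    rw [(hasDegree_hom v).vcoeff_deh ht, vcoeff_hom, if_pos ht]

/-- The vector `y^k V`. -/
noncomputable def yPow (k : ℕ) (V : Vect (Option (Fin n)) r K) : Vect (Option (Fin n)) r K :=
  monomial (Finsupp.single (none : Option (Fin n)) k) (1 : K) • V

theorem deh_yPow (k : ℕ) (V : Vect (Option (Fin n)) r K) : deh (yPow k V) = deh V := by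
  rw [yPow, deh_monomial_smul, Finsupp.some_single_none, ← C_apply, C_1, one_smul]

theorem HasDegree.yPow {d : ℤ} {V : Vect (Option (Fin n)) r K} (hV : HasDegree W δ d V) (k : ℕ) :
    HasDegree W δ (k + d) (yPow k V) := by
  simpa [SelfSat.yPow] using hV.monomial_smul (Finsupp.single none k) (1 : K)

theorem HasDegree.exists_eq_yPow_sat {d : ℤ} {V : Vect (Option (Fin n)) r K}
    (hV : HasDegree W δ d V) : ∃ k, V = SelfSat.yPow k (sat W δ V) := by
  by_cases h0 : deh V = 0
  · have hV0 : V = 0 := hV.eq_of_deh_eq (HasDegree.zero d) (by rw [h0, deh_zero])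
    have hs : hom W δ (0 : Vect (Fin n) r K) = 0 := vect_ext fun t => by simp [vcoeff_hom]
    refine ⟨0, ?_⟩
    rw [sat, h0, hs, hV0, SelfSat.yPow, smul_zero]
  -- The exponent k is read off a term of V whose dehomogenization has top degree: its power of y
  -- accounts for the difference between d and the top degree.
  · obtain ⟨s, hs, hd⟩ := exists_deg_eq_topDeg (W := W) (δ := δ) h0
    obtain ⟨t, rfl, ht⟩ := exists_of_vcoeff_deh_ne_zero hs
    have h1 := hV t ht
    rw [degBar, hd] at h1
    refine ⟨t.2 none, hV.eq_of_deh_eq ?_ ?_⟩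
    · rw [← h1]
      exact (hasDegree_hom (deh V)).yPow _
    · rw [deh_yPow, sat, deh_hom]

theorem yPow_zero (k : ℕ) : yPow k (0 : Vect (Option (Fin n)) r K) = 0 := smul_zero _

theorem sat_sat (V : Vect (Option (Fin n)) r K) : sat W δ V = sat W δ (sat W δ V) := by
  rw [sat, sat, deh_hom]

theorem HasDegree.sat_eq_zero_iff {d : ℤ} {V : Vect (Option (Fin n)) r K}
    (hV : HasDegree W δ d V) : sat W δ V = 0 ↔ V = 0 := by
  constructor
  · intro h
    obtain ⟨k, hk⟩ := hV.exists_eq_yPow_sat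
    rw [hk, h, yPow_zero]
  · rintro rfl
    rw [sat, deh_zero]
    exact vect_ext fun t => by simp [vcoeff_hom]

/-- Some term of the homogenization is free of y, namely one from a term of top degree. All terms
have the same degree over P̄, so the leading one is chosen by σ, which prefers a larger degree over
P and hence a smaller power of y. -/
theorem IsLeadingTerm.hom_none_eq_zero {σ : ModuleOrdering (Fin n) r} (hσ : σ.DegCompatible W δ)
    {v : Vect (Fin n) r K} {t : MTerm (Option (Fin n)) r}
    (ht : IsLeadingTerm (σ.extend W δ) (hom W δ v) t) : t.2 none = 0 := by
  have hv : v ≠ 0 := by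
    rintro rfl
    exact ht.1 (by simp [vcoeff_hom])
  obtain ⟨s, hs, hd⟩ := exists_deg_eq_topDeg (W := W) (δ := δ) hv
  obtain ⟨s', rfl, hs', -⟩ := exists_degBar_eq_topDeg (W := W) (δ := δ) hs
  have hdt : degBar W δ t = topDeg W δ v := hasDegree_hom v t ht.1
  have hle : deg W δ (dehTerm s') ≤ deg W δ (dehTerm t) := by
    rcases ht.2 s' (by rwa [vcoeff_hom, if_pos hs']) with h | ⟨-, h⟩
    · omega
    · exact hσ _ _ h
  rw [degBar] at hdt
  omega

/-! ### Homogeneous components and lifting from the dehomogenization. -/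

/-- The homogeneous component of degree `d`. -/
noncomputable def component (W : Fin n → ℤ) (δ : Fin r → ℤ) (d : ℤ)
    (V : Vect (Option (Fin n)) r K) : Vect (Option (Fin n)) r K :=
  fun i => ∑ b ∈ (V i).support with degBar W δ (i, b) = d, monomial b (coeff b (V i))

theorem vcoeff_component (d : ℤ) (V : Vect (Option (Fin n)) r K)
    (t : MTerm (Option (Fin n)) r) :
    vcoeff (component W δ d V) t = if degBar W δ t = d then vcoeff V t else 0 := by
  classical
  simp only [vcoeff, component, coeff_sum, coeff_monomial, Finset.sum_ite_eq', Finset.mem_filter,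
    mem_support_iff]
  by_cases h : coeff t.2 (V t.1) = 0 <;> simp [h]

theorem hasDegree_component (d : ℤ) (V : Vect (Option (Fin n)) r K) :
    HasDegree W δ d (component W δ d V) := by
  intro t ht
  by_contra h
  exact ht (by rw [vcoeff_component, if_neg h])

theorem component_zero (d : ℤ) : component W δ d (0 : Vect (Option (Fin n)) r K) = 0 :=
  vect_ext fun t => by simp [vcoeff_component]

theorem component_add (d : ℤ) (U V : Vect (Option (Fin n)) r K) :
    component W δ d (U + V) = component W δ d U + component W δ d V := by
  refine vect_ext fun t => ?_
  simp only [vcoeff_add, vcoeff_component]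
  split_ifs <;> simp

theorem component_monomial_smul (d : ℤ) (c : Option (Fin n) →₀ ℕ) (k : K)
    (V : Vect (Option (Fin n)) r K) :
    component W δ d (monomial c k • V) =
      monomial c k • component W δ (d - (c none + Finsupp.weight W c.some)) V := by
  refine vect_ext fun t => ?_
  rw [vcoeff_component]
  by_cases hc : ∃ b, t = (t.1, c + b)
  · obtain ⟨b, hb⟩ := hc
    have hd := degBar_add W δ (t.1, b) c
    dsimp only at hd
    rw [hb, vcoeff_monomial_smul, vcoeff_monomial_smul, vcoeff_component]
    split_ifs
    · rfl
    · omega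
    · omega
    · rw [mul_zero]
  · have h0 : ∀ U : Vect (Option (Fin n)) r K, vcoeff (monomial c k • U) t = 0 := by
      intro U
      by_contra h
      obtain ⟨s, hs, -⟩ := exists_of_vcoeff_monomial_smul_ne_zero h
      exact hc ⟨s.2, by rw [hs]⟩
    rw [h0, h0, ite_self]

theorem HasDegree.component_eq {e : ℤ} {V : Vect (Option (Fin n)) r K} (hV : HasDegree W δ e V)
    (d : ℤ) : component W δ d V = if d = e then V else 0 := by
  refine vect_ext fun t => ?_
  rw [vcoeff_component]
  by_cases h : vcoeff V t = 0
  · split_ifs <;> simp [h]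
  · rw [hV t h]
    by_cases hde : d = e
    · simp [hde]
    · rw [if_neg hde, if_neg (Ne.symm hde), vcoeff_zero]

/-- The saturation is generated by homogeneous vectors, and monomials merely shift components. This
reduces a general f in N^sat to homogeneous vectors. -/
theorem deh_component_mem {M : Submodule (MvPolynomial (Fin n) K) (Vect (Fin n) r K)}
    {f : Vect (Option (Fin n)) r K} (hf : f ∈ homModule W δ M) :
    ∀ d, deh (component W δ d f) ∈ M := by
  induction hf using Submodule.span_induction with
  | mem f hf =>
    obtain ⟨v, hv, rfl⟩ := hf
    intro d
    rw [(hasDegree_hom v).component_eq]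
    split_ifs
    · rwa [deh_hom]
    · rw [deh_zero]
      exact zero_mem _
  | zero =>
    intro d
    rw [component_zero, deh_zero]
    exact zero_mem _
  | add x y _ _ hx hy =>
    intro d
    rw [component_add, deh_add]
    exact Submodule.add_mem _ (hx d) (hy d)
  | smul q x _ hx =>
    induction q using MvPolynomial.induction_on' with
    | monomial c k =>
      intro d
      rw [component_monomial_smul, deh_monomial_smul]
      exact Submodule.smul_mem _ _ (hx _)
    | add p q hp hq =>
      intro d
      rw [add_smul, component_add, deh_add]
      exact Submodule.add_mem _ (hp d) (hq d)

theorem IsLeadingTerm.component {σ : ModuleOrdering (Fin n) r} {f : Vect (Option (Fin n)) r K}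
    {t : MTerm (Option (Fin n)) r} (ht : IsLeadingTerm (σ.extend W δ) f t) :
    IsLeadingTerm (σ.extend W δ) (component W δ (degBar W δ t) f) t := by
  refine ⟨by rw [vcoeff_component, if_pos rfl]; exact ht.1, fun s hs => ht.2 s fun h => hs ?_⟩
  rw [vcoeff_component, h, ite_self]

/-- The vectors over `P` that are dehomogenizations of homogeneous elements of `L`. -/
def DehHomogeneous (W : Fin n → ℤ) (δ : Fin r → ℤ)
    (L : Submodule (MvPolynomial (Option (Fin n)) K) (Vect (Option (Fin n)) r K))
    (m : Vect (Fin n) r K) : Prop :=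
  ∃ d, ∃ Z ∈ L, HasDegree W δ d Z ∧ deh Z = m

variable {L : Submodule (MvPolynomial (Option (Fin n)) K) (Vect (Option (Fin n)) r K)}

theorem DehHomogeneous.zero : DehHomogeneous W δ L (0 : Vect (Fin n) r K) :=
  ⟨0, 0, zero_mem _, HasDegree.zero 0, deh_zero⟩

/-- Powers of y bring both lifts to the same degree without changing their dehomogenizations. -/
theorem DehHomogeneous.add {m m' : Vect (Fin n) r K} (h : DehHomogeneous W δ L m)
    (h' : DehHomogeneous W δ L m') : DehHomogeneous W δ L (m + m') := by
  obtain ⟨d, Z, hZ, hd, rfl⟩ := h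
  obtain ⟨d', Z', hZ', hd', rfl⟩ := h'
  refine ⟨max d d', yPow (max d d' - d).toNat Z + yPow (max d d' - d').toNat Z',
    Submodule.add_mem _ (Submodule.smul_mem _ _ hZ) (Submodule.smul_mem _ _ hZ'), ?_, ?_⟩
  · have h1 := hd.yPow (max d d' - d).toNat
    have h2 := hd'.yPow (max d d' - d').toNat
    rw [show ((max d d' - d).toNat : ℤ) + d = max d d' by omega] at h1
    rw [show ((max d d' - d').toNat : ℤ) + d' = max d d' by omega] at h2
    exact h1.add h2
  · rw [deh_add, deh_yPow, deh_yPow]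

theorem DehHomogeneous.smul {m : Vect (Fin n) r K} (h : DehHomogeneous W δ L m)
    (q : MvPolynomial (Fin n) K) : DehHomogeneous W δ L (q • m) := by
  induction q using MvPolynomial.induction_on' with
  | monomial a k =>
    obtain ⟨d, Z, hZ, hd, rfl⟩ := h
    exact ⟨_, monomial (a.optionElim 0) k • Z, Submodule.smul_mem _ _ hZ, hd.monomial_smul _ _,
      by rw [deh_monomial_smul, Finsupp.some_optionElim]⟩
  | add p q hp hq =>
    rw [add_smul]
    exact hp.add hq

theorem dehHomogeneous_of_mem_dehModule {U : Set (Vect (Option (Fin n)) r K)}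
    (hU : ∀ u ∈ U, IsHomogeneousVec W δ u) (hUL : ∀ u ∈ U, u ∈ L) {m : Vect (Fin n) r K}
    (hm : m ∈ dehModule (Submodule.span (MvPolynomial (Option (Fin n)) K) U)) :
    DehHomogeneous W δ L m := by
  induction hm using Submodule.span_induction with
  | mem m hm =>
    obtain ⟨u, hu, rfl⟩ := hm
    induction hu using Submodule.span_induction with
    | mem u hu =>
      obtain ⟨d, hd⟩ := hU u hu
      exact ⟨d, u, hUL u hu, hd, rfl⟩
    | zero =>
      rw [deh_zero]
      exact DehHomogeneous.zero
    | add x y _ _ hx hy =>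
      rw [deh_add]
      exact hx.add hy
    | smul q x _ hx =>
      induction q using MvPolynomial.induction_on' with
      | monomial c k =>
        rw [deh_monomial_smul]
        exact hx.smul _
      | add p q hp hq =>
        rw [add_smul, deh_add]
        exact hp.add hq
  | zero => exact DehHomogeneous.zero
  | add x y _ _ hx hy => exact hx.add hy
  | smul q x _ hx => exact hx.smul q

/-- Once powers of y equalize the degrees, f and the homogeneous lift Z from L coincide. -/
theorem HasDegree.exists_yPow_mem {e : ℤ} {f : Vect (Option (Fin n)) r K}
    (hf : HasDegree W δ e f) (h : DehHomogeneous W δ L (deh f)) : ∃ k, SelfSat.yPow k f ∈ L := by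
  obtain ⟨d, Z, hZ, hd, hdeh⟩ := h
  have h1 := hd.yPow (max d e - d).toNat
  have h2 := hf.yPow (max d e - e).toNat
  rw [show ((max d e - d).toNat : ℤ) + d = max d e by omega] at h1
  rw [show ((max d e - e).toNat : ℤ) + e = max d e by omega] at h2
  refine ⟨(max d e - e).toNat, ?_⟩
  rw [h2.eq_of_deh_eq h1 (by rw [deh_yPow, deh_yPow, hdeh])]
  exact Submodule.smul_mem _ _ hZ

theorem deh_mem_dehModule {N : Submodule (MvPolynomial (Option (Fin n)) K)
    (Vect (Option (Fin n)) r K)} {V : Vect (Option (Fin n)) r K} (hV : V ∈ N) :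
    deh V ∈ dehModule N :=
  Submodule.subset_span ⟨V, hV, rfl⟩

/-- A set of saturated vectors whose leading terms control the submodule generated by it is a
Gröbner basis of the saturation. -/
theorem isGroebnerBasis_satModule (hW : ∀ j, 0 < W j) {σ : ModuleOrdering (Fin n) r}
    (hσ : σ.DegCompatible W δ) {U G : Set (Vect (Option (Fin n)) r K)}
    (hU : ∀ u ∈ U, IsHomogeneousVec W δ u)
    (hUG : ∀ u ∈ U, u ∈ Submodule.span (MvPolynomial (Option (Fin n)) K) G)
    (hG0 : ∀ g ∈ G, g ≠ 0) (hGs : ∀ g ∈ G, g = sat W δ g)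
    (hGM : ∀ g ∈ G, deh g ∈ dehModule (Submodule.span (MvPolynomial (Option (Fin n)) K) U))
    (hS : ∀ u ∈ G, ∀ v ∈ G, SVectorsReduce (σ.extend W δ) G u v) :
    IsGroebnerBasis (σ.extend W δ) G
      (satModule W δ (Submodule.span (MvPolynomial (Option (Fin n)) K) U)) := by
  have hwf := wellFounded_extend_lt hW δ σ
  refine isGroebnerBasis_of_leadDivisible hwf hG0 (fun g hg => ?_) fun f hf t ht => ?_
  · rw [hGs g hg]
    exact Submodule.subset_span ⟨_, hGM g hg, rfl⟩
  · have hd := hasDegree_component (W := W) (δ := δ) (degBar W δ t) f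
    obtain ⟨k, hk⟩ := hd.exists_yPow_mem
      (dehHomogeneous_of_mem_dehModule hU hUG (deh_component_mem hf (degBar W δ t)))
    obtain ⟨g, hg, b, hl, hb⟩ := leadDivisible_of_mem_span hwf hG0 hS hk
      (ht.component.monomial_smul (Finsupp.single none k) one_ne_zero)
    -- The factor y^k affects only the exponent of y, where LT(g) has exponent 0.
    refine ⟨g, hg, b, hl, fun o => ?_⟩
    cases o with
    | none =>
      rw [hGs g hg] at hl
      rw [hl.hom_none_eq_zero hσ]
      exact Nat.zero_le _
    | some j => simpa using hb (some j)

end Homogeneous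

/-! ### The loop invariant. -/

section Invariant

variable {n r : ℕ} {K : Type*} [Field K] {W : Fin n → ℤ} {δ : Fin r → ℤ}
  {σ : ModuleOrdering (Fin n) r}

theorem HasDegree.of_reduction {ρ : ModuleOrdering (Option (Fin n)) r}
    {G : List (Vect (Option (Fin n)) r K)} (hG : ∀ g ∈ G, IsHomogeneousVec W δ g)
    {w R : Vect (Option (Fin n)) r K} {d : ℤ} (hw : HasDegree W δ d w)
    (h : Relation.ReflTransGen (ReducesTo ρ G) w R) : HasDegree W δ d R := by
  induction h with
  | refl => exact hw
  | tail _ hstep ih =>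
    obtain ⟨g, hg, i, b, c, hl, hc, rfl⟩ := hstep
    exact ih.sub (HasDegree.monomial_smul_of_term (hG g hg) hl.1 _ (ih _ hc))

theorem IsSVector.isHomogeneousVec {ρ : ModuleOrdering (Option (Fin n)) r}
    {u v w : Vect (Option (Fin n)) r K} (h : IsSVector ρ u v w) (hu : IsHomogeneousVec W δ u)
    (hv : IsHomogeneousVec W δ v) : IsHomogeneousVec W δ w := by
  obtain ⟨i, a, b, ha, hb, rfl⟩ := h
  refine ⟨degBar W δ (i, a ⊔ b), HasDegree.sub ?_ ?_⟩
  · exact HasDegree.monomial_smul_of_term hu ha.1 _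
      (by rw [tsub_add_cancel_of_le le_sup_left])
  · exact HasDegree.monomial_smul_of_term hv hb.1 _
      (by rw [tsub_add_cancel_of_le le_sup_right])

theorem IsSVector.eq_sVector {ι : Type*} {ρ : ModuleOrdering ι r} {u v w : Vect ι r K}
    (h : IsSVector ρ u v w) {i : Fin r} {a b : ι →₀ ℕ} (ha : IsLeadingTerm ρ u (i, a))
    (hb : IsLeadingTerm ρ v (i, b)) : sVector u v i a b = w := by
  obtain ⟨j, a', b', ha', hb', rfl⟩ := h
  obtain ⟨rfl, rfl⟩ := Prod.mk.inj (ha.unique ha')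
  obtain ⟨-, rfl⟩ := Prod.mk.inj (hb.unique hb')
  rfl

theorem deh_mem_of_mem_span {M : Submodule (MvPolynomial (Fin n) K) (Vect (Fin n) r K)}
    {G : Set (Vect (Option (Fin n)) r K)} (hG : ∀ g ∈ G, deh g ∈ M)
    {f : Vect (Option (Fin n)) r K}
    (hf : f ∈ Submodule.span (MvPolynomial (Option (Fin n)) K) G) : deh f ∈ M := by
  induction hf using Submodule.span_induction with
  | mem g hg => exact hG g hg
  | zero =>
    rw [deh_zero]
    exact zero_mem _
  | add x y _ _ hx hy =>
    rw [deh_add]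
    exact Submodule.add_mem _ hx hy
  | smul q x _ hx =>
    induction q using MvPolynomial.induction_on' with
    | monomial c k =>
      rw [deh_monomial_smul]
      exact Submodule.smul_mem _ _ hx
    | add p q hp hq =>
      rw [add_smul, deh_add]
      exact Submodule.add_mem _ hp hq

/-- `w` has a representation by `G` none of whose terms exceeds all terms of `w`. -/
def HasRepresentation {ι : Type*} (ρ : ModuleOrdering ι r) (G : Set (Vect ι r K))
    (w : Vect ι r K) : Prop :=
  ∀ p : MTerm ι r → Prop, (∀ s t, ρ.le s t → p t → p s) → (∀ s, vcoeff w s ≠ 0 → p s) →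
    w ∈ repSpan ρ G p

/-- Keeping V in place of R is harmless, since R = y^k V is itself a multiple with leading term
LT(R). Allowing every down-set p serves two ends: the trivial one puts inputs into the span, and the
terms below an lcm treat S-vectors. -/
theorem hasRepresentation_of_reduction {ρ : ModuleOrdering (Option (Fin n)) r}
    {G G' : List (Vect (Option (Fin n)) r K)} (hGG' : ∀ g ∈ G, g ∈ G')
    {w R : Vect (Option (Fin n)) r K} (h : Relation.ReflTransGen (ReducesTo ρ G) w R)
    (hR : R = 0 ∨ ∃ V ∈ G', ∃ k, R = yPow k V) : HasRepresentation ρ {g | g ∈ G'} w := by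
  intro p hp hw
  obtain ⟨hR', hmem⟩ := reduction_mem_repSpan hp h hw
  have hmem' : w - R ∈ repSpan ρ {g | g ∈ G'} p := repSpan_mono hGG' (fun _ => id) hmem
  rw [← sub_add_cancel w R]
  refine Submodule.add_mem _ hmem' ?_
  obtain rfl | ⟨V, hV, k, rfl⟩ := hR
  · exact zero_mem _
  · by_cases h0 : V = 0
    · rw [h0, yPow_zero]
      exact zero_mem _
    · obtain ⟨⟨i, b⟩, hl⟩ := exists_isLeadingTerm ρ h0
      exact generator_mem_repSpan hV hl (hR' _ (hl.monomial_smul _ one_ne_zero).1)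

/-- The loop invariant of the algorithm on the input `U`; the vectors in `D` are removed from the
lists of generators and pairs, but still to be reduced. -/
structure Invariant (σ : ModuleOrdering (Fin n) r) (W : Fin n → ℤ) (δ : Fin r → ℤ)
    (M : Submodule (MvPolynomial (Fin n) K) (Vect (Fin n) r K))
    (U : List (Vect (Option (Fin n)) r K)) (D : Set (Vect (Option (Fin n)) r K))
    (s : State n r K) : Prop where
  gens_homogeneous : ∀ u ∈ s.gens, IsHomogeneousVec W δ u
  gens_mem : ∀ u ∈ s.gens, deh u ∈ M
  basis_ne_zero : ∀ v ∈ s.basis, v ≠ 0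
  basis_sat : ∀ v ∈ s.basis, v = sat W δ v
  basis_mem : ∀ v ∈ s.basis, deh v ∈ M
  pairs_mem : ∀ p ∈ s.pairs, p.1 ∈ s.basis ∧ p.2 ∈ s.basis ∧ SameComponent (σ.extend W δ) p.1 p.2
  input : ∀ u ∈ U, u ∈ s.gens ∨ u ∈ D ∨
    u ∈ Submodule.span (MvPolynomial (Option (Fin n)) K) {g | g ∈ s.basis}
  reduced : ∀ u ∈ s.basis, ∀ v ∈ s.basis, (u, v) ∈ s.pairs ∨ (v, u) ∈ s.pairs ∨
    (∃ w ∈ D, IsSVector (σ.extend W δ) u v w ∨ IsSVector (σ.extend W δ) v u w) ∨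
    SVectorsReduce (σ.extend W δ) {g | g ∈ s.basis} u v

variable {M : Submodule (MvPolynomial (Fin n) K) (Vect (Fin n) r K)}
  {U : List (Vect (Option (Fin n)) r K)} {D : Set (Vect (Option (Fin n)) r K)} {s s' : State n r K}

theorem isHomogeneousVec_of_eq_sat {V : Vect (Option (Fin n)) r K} (h : V = sat W δ V) :
    IsHomogeneousVec W δ V := by
  rw [h]
  exact ⟨_, hasDegree_hom _⟩

theorem Invariant.basis_homogeneous (h : Invariant σ W δ M U D s) :
    ∀ v ∈ s.basis, IsHomogeneousVec W δ v :=
  fun v hv => isHomogeneousVec_of_eq_sat (h.basis_sat v hv)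

theorem Invariant.init (hU : ∀ u ∈ U, IsHomogeneousVec W δ u) (hM : ∀ u ∈ U, deh u ∈ M) :
    Invariant σ W δ M U ∅ (State.init U) where
  gens_homogeneous := hU
  gens_mem := hM
  basis_ne_zero := by simp [State.init]
  basis_sat := by simp [State.init]
  basis_mem := by simp [State.init]
  pairs_mem := by simp [State.init]
  input := fun u hu => Or.inl hu
  reduced := by simp [State.init]

/-- The obligation attached to the removed generator or pair moves to D = {w}, and
`Invariant.finish` discharges it once w has a representation. -/
theorem Invariant.select {w : Vect (Option (Fin n)) r K} (h : Invariant σ W δ M U ∅ s)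
    (hw : Select (σ.extend W δ) s w s') :
    Invariant σ W δ M U {w} s' ∧ IsHomogeneousVec W δ w ∧ deh w ∈ M := by
  cases hw with
  | gen gens pairs G =>
    refine ⟨{ h with
      gens_homogeneous := fun u hu => h.gens_homogeneous u (Multiset.mem_cons_of_mem hu)
      gens_mem := fun u hu => h.gens_mem u (Multiset.mem_cons_of_mem hu)
      input := fun u hu => ?_
      reduced := fun u hu v hv => ?_ }, h.gens_homogeneous w (Multiset.mem_cons_self _ _),
      h.gens_mem w (Multiset.mem_cons_self _ _)⟩
    · rcases h.input u hu with h1 | h1 | h1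
      · rcases Multiset.mem_cons.1 h1 with rfl | h1
        · exact Or.inr (Or.inl rfl)
        · exact Or.inl h1
      · exact absurd h1 (Set.notMem_empty u)
      · exact Or.inr (Or.inr h1)
    · rcases h.reduced u hu v hv with h1 | h1 | ⟨w, hw, -⟩ | h1
      · exact Or.inl h1
      · exact Or.inr (Or.inl h1)
      · exact absurd hw (Set.notMem_empty w)
      · exact Or.inr (Or.inr (Or.inr h1))
  | pair a b _ gens pairs G hab =>
    obtain ⟨ha, hb, -⟩ := h.pairs_mem (a, b) (Multiset.mem_cons_self _ _)
    refine ⟨{ h with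
      pairs_mem := fun p hp => h.pairs_mem p (Multiset.mem_cons_of_mem hp)
      input := fun u hu => ?_
      reduced := fun u hu v hv => ?_ },
      hab.isHomogeneousVec (h.basis_homogeneous a ha) (h.basis_homogeneous b hb), ?_⟩
    · rcases h.input u hu with h1 | h1 | h1
      · exact Or.inl h1
      · exact absurd h1 (Set.notMem_empty u)
      · exact Or.inr (Or.inr h1)
    · rcases h.reduced u hu v hv with h1 | h1 | ⟨w, hw, -⟩ | h1
      · rcases Multiset.mem_cons.1 h1 with h1 | h1
        · obtain ⟨rfl, rfl⟩ := Prod.mk.inj h1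
          exact Or.inr (Or.inr (Or.inl ⟨w, rfl, Or.inl hab⟩))
        · exact Or.inl h1
      · rcases Multiset.mem_cons.1 h1 with h1 | h1
        · obtain ⟨rfl, rfl⟩ := Prod.mk.inj h1
          exact Or.inr (Or.inr (Or.inl ⟨w, rfl, Or.inr hab⟩))
        · exact Or.inr (Or.inl h1)
      · exact absurd hw (Set.notMem_empty w)
      · exact Or.inr (Or.inr (Or.inr h1))
    · obtain ⟨i, c, d, -, -, rfl⟩ := hab
      rw [deh_sub, deh_monomial_smul, deh_monomial_smul]
      exact Submodule.sub_mem _ (Submodule.smul_mem _ _ (h.basis_mem a ha))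
        (Submodule.smul_mem _ _ (h.basis_mem b hb))

theorem IsSVector.sVectorsReduce {ρ : ModuleOrdering (Option (Fin n)) r}
    {G : Set (Vect (Option (Fin n)) r K)} {u v w : Vect (Option (Fin n)) r K}
    (h : IsSVector ρ u v w) (hw : HasRepresentation ρ G w) : SVectorsReduce ρ G u v := by
  intro i a b ha hb
  have hlt := lt_of_vcoeff_sVector_ne_zero ha hb
  rw [h.eq_sVector ha hb] at hlt ⊢
  exact hw (ρ.lt · (i, a ⊔ b)) (fun _ _ => ModuleOrdering.lt_of_le_of_lt) hlt

theorem Invariant.finish {w : Vect (Option (Fin n)) r K} (h : Invariant σ W δ M U {w} s)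
    (hw : HasRepresentation (σ.extend W δ) {g | g ∈ s.basis} w) : Invariant σ W δ M U ∅ s := by
  refine { h with
    input := fun u hu => ?_
    reduced := fun u hu v hv => ?_ }
  · rcases h.input u hu with h1 | rfl | h1
    · exact Or.inl h1
    · exact Or.inr (Or.inr (mem_span_of_mem_repSpan
        (hw (fun _ => True) (fun _ _ _ _ => trivial) fun _ _ => trivial)))
    · exact Or.inr (Or.inr h1)
  · rcases h.reduced u hu v hv with h1 | h1 | ⟨w, rfl, h1 | h1⟩ | h1
    · exact Or.inl h1
    · exact Or.inr (Or.inl h1)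
    · exact Or.inr (Or.inr (Or.inr (h1.sVectorsReduce hw)))
    · exact Or.inr (Or.inr (Or.inr (h1.sVectorsReduce hw).symm))
    · exact Or.inr (Or.inr (Or.inr h1))

theorem mem_newPairs {ρ : ModuleOrdering (Option (Fin n)) r} {V : Vect (Option (Fin n)) r K}
    {G : List (Vect (Option (Fin n)) r K)}
    {p : Vect (Option (Fin n)) r K × Vect (Option (Fin n)) r K} :
    p ∈ newPairs ρ V G ↔ ∃ v ∈ G, SameComponent ρ V v ∧ p = (V, v) := by
  simp [newPairs, and_assoc, eq_comm]

theorem mem_newPairs_or_sVectorsReduce {ρ : ModuleOrdering (Option (Fin n)) r}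
    {V v : Vect (Option (Fin n)) r K} {G : List (Vect (Option (Fin n)) r K)} (hv : v ∈ G)
    (G' : Set (Vect (Option (Fin n)) r K)) :
    (V, v) ∈ newPairs ρ V G ∨ SVectorsReduce ρ G' V v := by
  by_cases h : SameComponent ρ V v
  · exact Or.inl (mem_newPairs.2 ⟨v, hv, h, rfl⟩)
  · exact Or.inr fun i a b ha hb => absurd ⟨i, a, b, ha, hb⟩ h

theorem Invariant.insert (h : Invariant σ W δ M U D s) {V : Vect (Option (Fin n)) r K}
    (h0 : V ≠ 0) (hV : V = sat W δ V) (hVM : deh V ∈ M) :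
    Invariant σ W δ M U D
      ⟨s.gens, s.pairs + newPairs (σ.extend W δ) V s.basis, V :: s.basis⟩ where
  gens_homogeneous := h.gens_homogeneous
  gens_mem := h.gens_mem
  basis_ne_zero := List.forall_mem_cons.2 ⟨h0, h.basis_ne_zero⟩
  basis_sat := List.forall_mem_cons.2 ⟨hV, h.basis_sat⟩
  basis_mem := List.forall_mem_cons.2 ⟨hVM, h.basis_mem⟩
  pairs_mem := by
    intro p hp
    rcases Multiset.mem_add.1 hp with hp | hp
    · obtain ⟨h1, h2, h3⟩ := h.pairs_mem p hp
      exact ⟨List.mem_cons_of_mem _ h1, List.mem_cons_of_mem _ h2, h3⟩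
    · obtain ⟨v, hv, hs, rfl⟩ := mem_newPairs.1 hp
      exact ⟨List.mem_cons_self, List.mem_cons_of_mem _ hv, hs⟩
  input := by
    intro u hu
    rcases h.input u hu with h1 | h1 | h1
    · exact Or.inl h1
    · exact Or.inr (Or.inl h1)
    · exact Or.inr (Or.inr (Submodule.span_mono (fun _ => List.mem_cons_of_mem _) h1))
  reduced := by
    intro u hu v hv
    rcases List.mem_cons.1 hu with hu | hu <;> rcases List.mem_cons.1 hv with hv | hv
    · rw [hu, hv]
      exact Or.inr (Or.inr (Or.inr SVectorsReduce.self))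
    · rw [hu]
      rcases mem_newPairs_or_sVectorsReduce (ρ := σ.extend W δ) (V := V) hv
        {g | g ∈ V :: s.basis} with h1 | h1
      · exact Or.inl (Multiset.mem_add.2 (Or.inr h1))
      · exact Or.inr (Or.inr (Or.inr h1))
    · rw [hv]
      rcases mem_newPairs_or_sVectorsReduce (ρ := σ.extend W δ) (V := V) hu
        {g | g ∈ V :: s.basis} with h1 | h1
      · exact Or.inr (Or.inl (Multiset.mem_add.2 (Or.inr h1)))
      · exact Or.inr (Or.inr (Or.inr h1.symm))
    · rcases h.reduced u hu v hv with h1 | h1 | h1 | h1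
      · exact Or.inl (Multiset.mem_add.2 (Or.inl h1))
      · exact Or.inr (Or.inl (Multiset.mem_add.2 (Or.inl h1)))
      · exact Or.inr (Or.inr (Or.inl h1))
      · exact Or.inr (Or.inr (Or.inr (h1.mono fun _ => List.mem_cons_of_mem _)))

/-! ### Progress of the loop and termination. -/

/-- The number of generators and pairs that are still to be treated. -/
def State.size (s : State n r K) : ℕ := s.gens.card + s.pairs.card

theorem Select.basis_eq {ρ : ModuleOrdering (Option (Fin n)) r} {w : Vect (Option (Fin n)) r K}
    (h : Select ρ s w s') : s'.basis = s.basis := by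
  cases h <;> rfl

theorem Select.size_lt {ρ : ModuleOrdering (Option (Fin n)) r} {w : Vect (Option (Fin n)) r K}
    (h : Select ρ s w s') : s'.size < s.size := by
  cases h <;> simp only [State.size, Multiset.card_cons] <;> omega

theorem not_leadDivisible_sat {ρ : ModuleOrdering (Option (Fin n)) r}
    {G : List (Vect (Option (Fin n)) r K)} {w R : Vect (Option (Fin n)) r K} {d : ℤ}
    (hR : IsRemainder ρ w G R) (hd : HasDegree W δ d R) {t : MTerm (Option (Fin n)) r}
    (ht : IsLeadingTerm ρ (sat W δ R) t) : ¬ LeadDivisible ρ {g | g ∈ G} t := by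
  rintro ⟨g, hg, b, hl, hb⟩
  obtain ⟨k, hk⟩ := hd.exists_eq_yPow_sat
  refine hR.2 g hg t.1 (Finsupp.single none k + t.2) b ?_ hl (le_add_of_le_right hb)
  rw [hk]
  exact ht.monomial_smul _ one_ne_zero

theorem Invariant.step (h : Invariant σ W δ M U ∅ s) (hs : Step σ W δ s s') :
    Invariant σ W δ M U ∅ s' ∧
      ((s'.basis = s.basis ∧ s'.size < s.size) ∨
        ∃ V t, s'.basis = V :: s.basis ∧ IsLeadingTerm (σ.extend W δ) V t ∧
          ¬ LeadDivisible (σ.extend W δ) {g | g ∈ s.basis} t) := by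
  have deh_mem : ∀ {w R : Vect (Option (Fin n)) r K} {s₁ : State n r K},
      Invariant σ W δ M U {w} s₁ → deh w ∈ M → IsRemainder (σ.extend W δ) w s₁.basis R →
      deh R ∈ M := by
    intro w R s₁ h1 hwM hR
    have hmem := mem_span_of_mem_repSpan (reduction_mem_repSpan (p := fun _ => True)
      (fun _ _ _ _ => trivial) hR.1 fun _ _ => trivial).2
    have := Submodule.sub_mem _ hwM (deh_mem_of_mem_span h1.basis_mem hmem)
    rwa [deh_sub, sub_sub_cancel] at this
  cases hs with
  | discard s' w R hw hR h0 =>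
    obtain ⟨h1, ⟨d, hd⟩, -⟩ := h.select hw
    have hRd : HasDegree W δ d R := HasDegree.of_reduction h1.basis_homogeneous hd hR.1
    exact ⟨h1.finish (hasRepresentation_of_reduction (fun _ => id) hR.1
      (Or.inl (hRd.sat_eq_zero_iff.1 h0))), Or.inl ⟨hw.basis_eq, hw.size_lt⟩⟩
  | keep s₁ w R hw hR h0 =>
    obtain ⟨h1, ⟨d, hd⟩, hwM⟩ := h.select hw
    have hRd : HasDegree W δ d R := HasDegree.of_reduction h1.basis_homogeneous hd hR.1
    have hVM : deh (sat W δ R) ∈ M := by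
      rw [sat, deh_hom]
      exact deh_mem h1 hwM hR
    -- V has to join the basis before w is discharged, because the representation of w uses V.
    refine ⟨(h1.insert h0 (sat_sat R) hVM).finish (hasRepresentation_of_reduction
      (fun _ => List.mem_cons_of_mem _) hR.1
      (Or.inr ⟨_, List.mem_cons_self, hRd.exists_eq_yPow_sat⟩)), Or.inr ?_⟩
    obtain ⟨t, ht⟩ := exists_isLeadingTerm (σ.extend W δ) h0
    refine ⟨_, t, by rw [hw.basis_eq], ht, ?_⟩
    rw [← hw.basis_eq]
    exact not_leadDivisible_sat hR hRd ht

theorem Invariant.of_reachable (hU : ∀ u ∈ U, IsHomogeneousVec W δ u) (hM : ∀ u ∈ U, deh u ∈ M)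
    (hs : Reachable σ W δ U s) : Invariant σ W δ M U ∅ s := by
  induction hs with
  | refl => exact Invariant.init hU hM
  | tail _ hstep ih => exact (ih.step hstep).1

theorem Invariant.exists_step (hW : ∀ j, 0 < W j) (h : Invariant σ W δ M U ∅ s)
    (hs : ¬ s.IsFinal) : ∃ s', Step σ W δ s s' := by
  have hsel : ∃ w s', Select (σ.extend W δ) s w s' := by
    obtain ⟨gens, pairs, G⟩ := s
    by_cases hg : gens = 0
    · have hp : pairs ≠ 0 := fun hp => hs ⟨hg, hp⟩
      obtain ⟨⟨u, v⟩, hmem⟩ := Multiset.exists_mem_of_ne_zero hp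
      obtain ⟨-, -, i, a, b, ha, hb⟩ := h.pairs_mem _ hmem
      obtain ⟨pairs, rfl⟩ := Multiset.exists_cons_of_mem hmem
      exact ⟨_, _, Select.pair u v _ gens pairs G ⟨i, a, b, ha, hb, rfl⟩⟩
    · obtain ⟨u, hmem⟩ := Multiset.exists_mem_of_ne_zero hg
      obtain ⟨gens, rfl⟩ := Multiset.exists_cons_of_mem hmem
      exact ⟨u, _, Select.gen u gens pairs G⟩
  obtain ⟨w, s', hw⟩ := hsel
  obtain ⟨R, hR⟩ := exists_isRemainder (wellFounded_extend_lt hW δ σ) s'.basis w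
  by_cases h0 : sat W δ R = 0
  · exact ⟨_, Step.discard s s' w R hw hR h0⟩
  · exact ⟨_, Step.keep s s' w R hw hR h0⟩

theorem not_exists_infinite_run (hU : ∀ u ∈ U, IsHomogeneousVec W δ u) :
    ¬ ∃ run : ℕ → State n r K, run 0 = State.init U ∧
      ∀ k, Step σ W δ (run k) (run (k + 1)) := by
  rintro ⟨run, h0, hrun⟩
  -- Membership in N^deh plays no role in termination, so M is the whole module.
  have hinv : ∀ k, Invariant σ W δ ⊤ U ∅ (run k) := by
    intro k
    induction k with
    | zero =>
      rw [h0]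
      exact Invariant.init hU fun _ _ => trivial
    | succ k ih => exact (ih.step (hrun k)).1
  have hstep := fun k => ((hinv k).step (hrun k)).2
  have hmono : Monotone fun k => {g | g ∈ (run k).basis} := by
    refine monotone_nat_of_le_succ fun k => ?_
    rcases hstep k with ⟨h, -⟩ | ⟨V, t, h, -⟩
    · exact (congrArg (fun G : List (Vect (Option (Fin n)) r K) => {g | g ∈ G}) h).ge
    · intro g hg
      exact h ▸ List.mem_cons_of_mem V hg
  by_cases hfreq : ∃ᶠ k in Filter.atTop, ∃ V t, (run (k + 1)).basis = V :: (run k).basis ∧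
      IsLeadingTerm (σ.extend W δ) V t ∧
        ¬ LeadDivisible (σ.extend W δ) {g | g ∈ (run k).basis} t
  · obtain ⟨φ, hφ, h⟩ := Filter.extraction_of_frequently_atTop hfreq
    choose V t hb hl hdiv using h
    -- Among infinitely many added vectors, an earlier leading term divides a later one, although
    -- the earlier vector was already in the basis.
    obtain ⟨j, k, hjk, h1, h2⟩ := wellQuasiOrdered_mterm (Option (Fin n)) r t
    refine hdiv k ⟨V j, ?_, (t j).2, h1 ▸ hl j, h2⟩
    have hle : φ j + 1 ≤ φ k := hφ hjk
    refine hmono hle ?_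
    rw [Set.mem_ofPred_eq, hb]
    exact List.mem_cons_self
  · rw [Filter.not_frequently, Filter.eventually_atTop] at hfreq
    -- From m on nothing is added, so the number of open generators and pairs would decrease
    -- forever.
    obtain ⟨m, hm⟩ := hfreq
    have hlt : ∀ k, (run (m + (k + 1))).size < (run (m + k)).size := fun k =>
      ((hstep (m + k)).resolve_right (hm _ (Nat.le_add_right m k))).2
    exact (RelEmbedding.natGT (r := (· < ·)) (fun k => (run (m + k)).size) hlt).not_wellFounded
      wellFounded_lt

end Invariant

end SelfSat

theorem mainTheorem6 {K : Type*} [Field K] {n r : ℕ}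
    (W : Fin n → ℤ) (hW : ∀ j, 0 < W j) (δ : Fin r → ℤ)
    (σ : SelfSat.ModuleOrdering (Fin n) r)
    (N : Submodule (MvPolynomial (Option (Fin n)) K) (SelfSat.Vect (Option (Fin n)) r K))
    (U : List (SelfSat.Vect (Option (Fin n)) r K))
    (hU : ∀ u ∈ U, SelfSat.IsHomogeneousVec W δ u)
    (hN : Submodule.span (MvPolynomial (Option (Fin n)) K) {u | u ∈ U} = N) :
    -- every run ends: it never gets stuck before the end of the loop, and it is not infinite
    (∀ s, SelfSat.Reachable σ W δ U s → ¬ s.IsFinal → ∃ s', SelfSat.Step σ W δ s s') ∧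
    (¬ ∃ run : ℕ → SelfSat.State n r K, run 0 = SelfSat.State.init U ∧
      ∀ k, SelfSat.Step σ W δ (run k) (run (k + 1))) ∧
    -- the properties of every output
    (∀ G, SelfSat.IsOutput σ W δ U G →
      (∀ V ∈ G, V = SelfSat.sat W δ V) ∧
      (σ.DegCompatible W δ →
        SelfSat.IsGroebnerBasis (σ.extend W δ) {V | V ∈ G} (SelfSat.satModule W δ N))) := by
  subst hN
  have hinv : ∀ s, SelfSat.Reachable σ W δ U s → SelfSat.Invariant σ W δ
      (SelfSat.dehModule (Submodule.span _ {u | u ∈ U})) U ∅ s := fun s hs =>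
    SelfSat.Invariant.of_reachable hU
      (fun u hu => SelfSat.deh_mem_dehModule (Submodule.subset_span hu)) hs
  refine ⟨fun s hs hf => (hinv s hs).exists_step hW hf,
    SelfSat.not_exists_infinite_run hU, ?_⟩
  rintro _ ⟨s, hs, ⟨hg, hp⟩, rfl⟩
  have h := hinv s hs
  refine ⟨h.basis_sat, fun hσ => ?_⟩
  -- In a final state both lists and D are empty, so only the last alternatives of the invariant
  -- remain: inputs lie in the span, and S-vectors reduce.
  refine SelfSat.isGroebnerBasis_satModule hW hσ hU (fun u hu => ?_) h.basis_ne_zero h.basis_sat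
    h.basis_mem fun u hu v hv => ?_
  · rcases h.input u hu with h1 | h1 | h1
    · simp [hg] at h1
    · exact absurd h1 (Set.notMem_empty u)
    · exact h1
  · rcases h.reduced u hu v hv with h1 | h1 | ⟨w, hw, -⟩ | h1
    · simp [hp] at h1
    · simp [hp] at h1
    · exact absurd hw (Set.notMem_empty w)
    · exact h1
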